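/- Let $\Bbbk$ be an integral domain of characteristic $0$, let $\ell$ be a positive integer, let $\varepsilon^{1/2}$ be a primitive $\ell$-th root of unity in an algebraic closure of the fraction field of $\Bbbk$, and set $\mathcal A=\Bbbk[\varepsilon^{1/2}]$. Let $\widetilde B=\begin{bmatrix}0&1\\-1&0\end{bmatrix}$, with no frozen variables, and let $\Lambda(f,g)=f_1g_2-f_2g_1 \bmod \ell$ for $f,g\in\mathbb Z^2$. Let $M_\varepsilon:\mathbb Z^2\to\mathcal F_\varepsilon$ be a root of unity toric frame with matrix $\Lambda$ of a division $\mathcal A$-algebra $\mathcal F_\varepsilon$. This means that the elements $M_\varepsilon(f)$ are linearly independent over $\mathcal A$, that $M_\varepsilon(f)M_\varepsilon(g)=\varepsilon^{\Lambda(f,g)/2}M_\varepsilon(f+g)$, and that $\mathcal F_\varepsilon$ is the division algebra of fractions of $\mathcal T_\varepsilon(M_\varepsilon)=\mathrm{Span}_{\mathcal A}\{M_\varepsilon(f)\}$. Let $\mathsf A_\varepsilon(M_\varepsilon,\widetilde B)\subseteq\mathcal F_\varepsilon$ be the root of unity quantum cluster algebra, that is, the $\mathcal A$-subalgebra generated by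 the elements $M''_\varepsilon(e_1),M''_\varepsilon(e_2)$ for all seeds $(M''_\varepsilon,\widetilde B'')$ mutation-equivalent to $(M_\varepsilon,\widetilde B)$. Let $\mathsf U_\varepsilon(M_\varepsilon,\widetilde B)$ be the root of unity upper quantum cluster algebra, that is, the intersection of the quantum tori $\mathcal T_\varepsilon(M''_\varepsilon)$ of all these seeds. Put $$X_1=M_\varepsilon(e_1),\quad X_2=M_\varepsilon(e_2),\quad Y_1=M_\varepsilon(-e_1+e_2)+M_\varepsilon(-e_1),\quad Y_2=M_\varepsilon(e_1-e_2)+M_\varepsilon(-e_2).$$ Let $R$ be the $\mathcal A$-algebra with generators $x_1,x_2,y_1,y_2$ and relations $$x_2x_1=\varepsilon^{-1}x_1x_2,\quad y_2x_1=\varepsilon x_1y_2,\quad x_2y_1=\varepsilon y_1x_2,$$ $$x_1y_1=1+\varepsilon^{1/2}x_2,\quad y_1x_1=1+\varepsilon^{-1/2}x_2,\quad x_2y_2=1+\varepsilon^{-1/2}x_1,\quad y_2x_2=1+\varepsilon^{1/2}x_1,$$ $$y_2y_1=\varepsilon^{-1}y_1y_2+(1-\varepsilon^{-1}).$$ Then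 the following hold. 1. There is an isomorphism of $\mathcal A$-algebras $\theta:R\to\mathsf A_\varepsilon(M_\varepsilon,\widetilde B)$ with $\theta(x_k)=X_k$ and $\theta(y_k)=Y_k$ for $k=1,2$. Moreover, $\mathsf A_\varepsilon(M_\varepsilon,\widetilde B)=\mathsf U_\varepsilon(M_\varepsilon,\widetilde B)$. The monomials $y_1^{m_1}x_1^{n_1}x_2^{n_2}y_2^{m_2}$ with $m_1,n_1,n_2,m_2\in\mathbb N$ and $\min(m_1,n_1)=\min(m_2,n_2)=0$ form an $\mathcal A$-basis of $R$, and the corresponding monomials $Y_1^{m_1}X_1^{n_1}X_2^{n_2}Y_2^{m_2}$ form an $\mathcal A$-basis of $\mathsf A_\varepsilon(M_\varepsilon,\widetilde B)$. 2. If $\mathcal A$ is completely integrally closed (for example, if $\Bbbk$ is a field or $\Bbbk=\mathbb Z$), then $R$ is a maximal order in a central simple algebra. That is, $R$ embeds in a finite-dimensional simple algebra $S$ over its center such that every element of $S$ has the form $ab^{-1}$ and the form $c^{-1}d$ with $a,b,c,d\in R$, and $R$ is maximal among the orders $R'$ of $S$ that are equivalent to it (meaning $aRb\subseteq R'$ and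 $a'R'b'\subseteq R$ for some units $a,b,a',b'$ of $S$). -/

import Mathlib

universe u v w

namespace RootCluster

noncomputable section

/-! ## The coefficient ring -/

section BaseRing

variable (k : Type u) [CommRing k] {K : Type w} [Field K] [Algebra k K]

/-- For an element `ζ = ε^{1/2}` of an extension `K` of `k`, the subalgebra `k[ε^{1/2}]` of `K`,
as a ring. -/
def BaseRing (ζ : K) : Type w := (Algebra.adjoin k {ζ} : Subalgebra k K)

instance (ζ : K) : CommRing (BaseRing k ζ) :=
  inferInstanceAs (CommRing (Algebra.adjoin k {ζ} : Subalgebra k K))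

instance (ζ : K) : IsDomain (BaseRing k ζ) :=
  inferInstanceAs (IsDomain (Algebra.adjoin k {ζ} : Subalgebra k K))

/-- A root of unity `ε^{1/2}` as a unit of `k[ε^{1/2}]`. -/
def epsHalf {ℓ : ℕ} {ζ : K} (hℓ : 0 < ℓ) (hζ : IsPrimitiveRoot ζ ℓ) : (BaseRing k ζ)ˣ where
  val := ⟨ζ, Algebra.self_mem_adjoin_singleton k ζ⟩
  inv := ⟨ζ ^ (ℓ - 1), pow_mem (Algebra.self_mem_adjoin_singleton k ζ) _⟩
  val_inv := Subtype.ext (by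
    change ζ * ζ ^ (ℓ - 1) = 1
    rw [mul_pow_sub_one hℓ.ne', hζ.pow_eq_one])
  inv_val := Subtype.ext (by
    change ζ ^ (ℓ - 1) * ζ = 1
    rw [pow_sub_one_mul hℓ.ne', hζ.pow_eq_one])

end BaseRing

/-- A commutative domain `A` is completely integrally closed: an element `s` of its field of
fractions for which some nonzero `r` in `A` satisfies `r s ^ n ∈ A` for all `n` lies in `A`. -/
def IsCompletelyIntegrallyClosed (A : Type u) [CommRing A] [IsDomain A] : Prop :=
  completeIntegralClosure A (FractionRing A) = ⊥

/-! ## Orders in central simple algebras -/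

section Orders

variable {S : Type u} [Ring S]

/-- `R` is an order in `S`: every element of `S` is of the form `a b⁻¹` and of the form
`c⁻¹ d` with `a, b, c, d ∈ R`. -/
def IsOrderIn (R : Subring S) : Prop :=
  ∀ x : S,
    (∃ a ∈ R, ∃ b : Sˣ, (b : S) ∈ R ∧ x = a * ((b⁻¹ : Sˣ) : S)) ∧
    (∃ c : Sˣ, (c : S) ∈ R ∧ ∃ d ∈ R, x = ((c⁻¹ : Sˣ) : S) * d)

/-- Equivalence of orders: `a R b ⊆ R'` and `a' R' b' ⊆ R` for some units of `S`. -/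
def OrdersEquivalent (R R' : Subring S) : Prop :=
  ∃ a b a' b' : Sˣ,
    (∀ r ∈ R, (a : S) * r * (b : S) ∈ R') ∧ (∀ r ∈ R', (a' : S) * r * (b' : S) ∈ R)

/-- An order of `S` that is maximal, with respect to inclusion, in its equivalence class. -/
def IsMaximalOrderIn (R : Subring S) : Prop :=
  IsOrderIn R ∧
    ∀ R' : Subring S, IsOrderIn R' → OrdersEquivalent R R' → R ≤ R' → R' = R

/-- The ring `R` is a maximal order in a central simple algebra: it embeds in a finite
dimensional simple algebra `S` with center a field `Q`, as a maximal order of `S`. -/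
def IsMaximalOrder (R : Type u) [Ring R] : Prop :=
  ∃ (Q S : Type u) (_ : Field Q) (_ : Ring S) (_ : Algebra Q S),
    Algebra.IsCentral Q S ∧ IsSimpleRing S ∧ FiniteDimensional Q S ∧
      ∃ φ : R →+* S, Function.Injective φ ∧ IsMaximalOrderIn φ.range

end Orders

/-! ## Root of unity quantum cluster algebras without frozen variables -/

section Cluster

variable {A : Type u} [CommRing A] {ι : Type} [Fintype ι] [DecidableEq ι] {ℓ : ℕ}
variable {F : Type v} [DivisionRing F] [Algebra A F]

/-- The bicharacter `ℤ^N × ℤ^N → ℤ/ℓ` with matrix `Λ`. -/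
def bichar (Λ : Matrix ι ι (ZMod ℓ)) (f g : ι → ℤ) : ZMod ℓ :=
  ∑ i, ∑ j, (f i : ZMod ℓ) * Λ i j * (g j : ZMod ℓ)

/-- `(ε^{1/2})^c` for a residue class `c` modulo `ℓ`, where `q = ε^{1/2}` satisfies `q ^ ℓ = 1`. -/
def epsPow (q : Aˣ) (c : ZMod ℓ) : A := ((q ^ (ZMod.cast c : ℤ) : Aˣ) : A)

/-- The quantum torus `T(M)` of a toric frame `M`, the subalgebra of `F` spanned by the `M f`. -/
def quantumTorus (A : Type u) [CommRing A] [Algebra A F] (M : (ι → ℤ) → F) : Subalgebra A F :=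
  Algebra.adjoin A (Set.range M)

/-- `M` is a root of unity toric frame of `F` with matrix `Λ`. The quantum torus of `Λ` has the
`A`-basis `X^f`, `f ∈ ℤ^N`, with `X^f X^g = ε^{Λ(f,g)/2} X^{f+g}`; the first two fields say that
`X^f ↦ M f` is an embedding of algebras of it in `F`, and the third that `F` is the division
algebra of fractions of the image. -/
structure IsToricFrame (q : Aˣ) (Λ : Matrix ι ι (ZMod ℓ)) (M : (ι → ℤ) → F) : Prop where
  mul : ∀ f g, M f * M g = epsPow q (bichar Λ f g) • M (f + g)
  linearIndependent : LinearIndependent A M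
  fractions : ∀ x : F, ∃ a ∈ quantumTorus A M, ∃ b ∈ quantumTorus A M, b ≠ 0 ∧ x = a * b⁻¹

/-- The data of a root of unity quantum seed: a toric frame, its matrix, and the exchange
matrix. -/
structure Seed (ι : Type) (ℓ : ℕ) (F : Type v) where
  /-- The toric frame `M`. -/
  frame : (ι → ℤ) → F
  /-- The matrix `Λ` of the toric frame. -/
  form : Matrix ι ι (ZMod ℓ)
  /-- The exchange matrix `B`. -/
  exch : Matrix ι ι ℤ

/-- The standard basis vector `e_i` of `ℤ^N`. -/
def stdVec (i : ι) : ι → ℤ := Pi.single i 1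

/-- Mutation of exchange matrices. The division is exact. -/
def mutExch (k : ι) (B : Matrix ι ι ℤ) : Matrix ι ι ℤ :=
  Matrix.of fun i j =>
    if i = k ∨ j = k then -B i j
    else B i j + (|B i k| * B k j + B i k * |B k j|) / 2

/-- The vector `-e_k + [b^k]_+`, where `b^k` is the `k`-th column of `B`. -/
def posVec (k : ι) (B : Matrix ι ι ℤ) : ι → ℤ := -stdVec k + fun i => max (B i k) 0

/-- The vector `-e_k - [b^k]_-`, where `b^k` is the `k`-th column of `B`. -/
def negVec (k : ι) (B : Matrix ι ι ℤ) : ι → ℤ := -stdVec k - fun i => min (B i k) 0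

/-- The new cluster variable `M(-e_k + [b^k]_+) + M(-e_k - [b^k]_-)` of a mutation. -/
def newVar (k : ι) (s : Seed ι ℓ F) : F :=
  s.frame (posVec k s.exch) + s.frame (negVec k s.exch)

/-- The matrix of the mutated frame, `Eᵀ Λ E`, where `E` sends `e_k` to `-e_k + [b^k]_+` and
fixes the other basis vectors. -/
def mutForm (k : ι) (s : Seed ι ℓ F) : Matrix ι ι (ZMod ℓ) :=
  let E : ι → ι → ℤ := fun i => if i = k then posVec k s.exch else stdVec i
  Matrix.of fun i j => bichar s.form (E i) (E j)

/-- The mutated toric frame `M'` with matrix `Λ'`: its values at the `e_i` are `M(e_i)` for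
`i ≠ k` and the new variable for `i = k`. As `M'(g) M'(h) = ε^{Λ'(g,h)/2} M'(g+h)`, this
determines `M'`: writing `f = f° + f_k e_k` with `f°` of `k`-th coordinate zero, one has
`M'(f°) = M(f°)` and `M'(f) = ε^{-Λ'(f°, f_k e_k)/2} M(f°) M'(e_k)^{f_k}`. -/
def mutFrame (q : Aˣ) (k : ι) (s : Seed ι ℓ F) : (ι → ℤ) → F := fun f =>
  epsPow q (-bichar (mutForm k s) (Function.update f k 0) (f k • stdVec k)) •
    (s.frame (Function.update f k 0) * newVar k s ^ f k)

/-- Seed mutation in direction `k`. -/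
def Seed.mutate (q : Aˣ) (k : ι) (s : Seed ι ℓ F) : Seed ι ℓ F where
  frame := mutFrame q k s
  form := mutForm k s
  exch := mutExch k s.exch

/-- The second seed is obtained from the first by a finite sequence of mutations. -/
def MutEquiv (q : Aˣ) : Seed ι ℓ F → Seed ι ℓ F → Prop :=
  Relation.ReflTransGen fun s t => ∃ k, t = s.mutate q k

/-- The root of unity quantum cluster algebra: the subalgebra generated by the cluster variables
of all seeds that are mutation-equivalent to `s`. -/
def clusterAlgebra (q : Aˣ) (s : Seed ι ℓ F) : Subalgebra A F :=
  Algebra.adjoin A {x | ∃ t, MutEquiv q s t ∧ ∃ i, x = t.frame (stdVec i)}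

/-- The root of unity upper quantum cluster algebra: the intersection of the quantum tori of all
seeds that are mutation-equivalent to `s`. -/
def upperClusterAlgebra (q : Aˣ) (s : Seed ι ℓ F) : Subalgebra A F :=
  ⨅ (t : Seed ι ℓ F) (_ : MutEquiv q s t), quantumTorus A t.frame

end Cluster

/-! ## Type `A₂` -/

section TypeA2

variable {F : Type v}

/-- The exchange matrix of type `A₂`. -/
def exchA2 : Matrix (Fin 2) (Fin 2) ℤ := !![0, 1; -1, 0]

/-- The reduction modulo `ℓ` of the exchange matrix of type `A₂`. -/
def formA2 (ℓ : ℕ) : Matrix (Fin 2) (Fin 2) (ZMod ℓ) := exchA2.map (Int.cast : ℤ → ZMod ℓ)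

/-- The initial seed of type `A₂` with toric frame `M`. -/
def seedA2 (ℓ : ℕ) (M : (Fin 2 → ℤ) → F) : Seed (Fin 2) ℓ F where
  frame := M
  form := formA2 ℓ
  exch := exchA2

/-- The generators of the presented algebra. -/
inductive Gen
  | x1 | x2 | y1 | y2

variable {A : Type u} [CommRing A]

open FreeAlgebra in
/-- The defining relations, with `q = ε^{1/2}` and `ε = q ^ 2`. -/
inductive Rel (q : Aˣ) : FreeAlgebra A Gen → FreeAlgebra A Gen → Prop
  | x2x1 : Rel q (ι A Gen.x2 * ι A Gen.x1)
      (((q ^ (-2 : ℤ) : Aˣ) : A) • (ι A Gen.x1 * ι A Gen.x2))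
  | y2x1 : Rel q (ι A Gen.y2 * ι A Gen.x1)
      (((q ^ (2 : ℤ) : Aˣ) : A) • (ι A Gen.x1 * ι A Gen.y2))
  | x2y1 : Rel q (ι A Gen.x2 * ι A Gen.y1)
      (((q ^ (2 : ℤ) : Aˣ) : A) • (ι A Gen.y1 * ι A Gen.x2))
  | x1y1 : Rel q (ι A Gen.x1 * ι A Gen.y1) (1 + (q : A) • ι A Gen.x2)
  | y1x1 : Rel q (ι A Gen.y1 * ι A Gen.x1) (1 + ((q⁻¹ : Aˣ) : A) • ι A Gen.x2)
  | x2y2 : Rel q (ι A Gen.x2 * ι A Gen.y2) (1 + ((q⁻¹ : Aˣ) : A) • ι A Gen.x1)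
  | y2x2 : Rel q (ι A Gen.y2 * ι A Gen.x2) (1 + (q : A) • ι A Gen.x1)
  | y2y1 : Rel q (ι A Gen.y2 * ι A Gen.y1)
      (((q ^ (-2 : ℤ) : Aˣ) : A) • (ι A Gen.y1 * ι A Gen.y2) +
        algebraMap A (FreeAlgebra A Gen) (1 - ((q ^ (-2 : ℤ) : Aˣ) : A)))

/-- The `A`-algebra `R` with generators `x₁, x₂, y₁, y₂` and the relations above. -/
abbrev PresentedAlgebra (q : Aˣ) : Type u := RingQuot (Rel q)

/-- The class in `R` of a generator. -/
def gen (q : Aˣ) (g : Gen) : PresentedAlgebra q :=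
  RingQuot.mkAlgHom A (Rel q) (FreeAlgebra.ι A g)

/-- The exponents `(m₁, n₁, n₂, m₂)` with `min(m₁, n₁) = min(m₂, n₂) = 0`. -/
abbrev PBWIndex : Type :=
  {p : ℕ × ℕ × ℕ × ℕ // min p.1 p.2.1 = 0 ∧ min p.2.2.2 p.2.2.1 = 0}

/-- The monomial `y₁^{m₁} x₁^{n₁} x₂^{n₂} y₂^{m₂}` in elements of a monoid. -/
def pbwMonomial {T : Type*} [Monoid T] (x1 x2 y1 y2 : T) (p : PBWIndex) : T :=
  y1 ^ p.1.1 * x1 ^ p.1.2.1 * x2 ^ p.1.2.2.1 * y2 ^ p.1.2.2.2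

end TypeA2

end

end RootCluster

open RootCluster

/-!
The defining relations rewrite every word of `R` as a combination of the ordered monomials, and in
the quantum torus these monomials have distinct leading terms; hence they form a basis and `R`
embeds in the torus. The elements `x₁`, `x₂`, `y₁`, `y₂` and a fifth one, a polynomial in `y₁` and
`y₂`, form a pentagon that mutations rotate or reflect, so `R` is the cluster algebra. An element of
the upper cluster algebra lies in the tori of `(x₁, x₂)`, `(y₁, x₂)` and `(x₁, y₂)`, so that high
powers of `x₁` and of `x₂` multiply it into `R`; the relation `x₁ y₁ = 1 + ε^{1/2} x₂` makes it
possible to cancel these powers.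

For maximality it suffices, as the fractions of `R` have central denominators, to show `R' ⊆ R` for
every ring `R'` containing `R` with `e R' ⊆ R` for a nonzero central `e`. Since `R` is the
intersection of the three tori, `R` may be replaced by each of them. There the products `e xⁿ`,
for `x ∈ R'`, bound the leading index of `x`, and complete integral closedness of `A` shows that the
leading coefficient of `e` divides that of `e x`, so the leading term of `x` can be subtracted.
-/

namespace RootCluster

/-! ## Twisted group algebras and leading forms -/

section SpanOn

variable {A E G : Type*} [Semiring A] [AddCommMonoid E] [Module A E]

/-- The span of the members of a family with index in `S`. -/
def spanOn (A : Type*) [Semiring A] [Module A E] (m : G → E) (S : Set G) : Submodule A E :=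
  Submodule.span A (m '' S)

theorem mem_spanOn (m : G → E) {S : Set G} {f : G} (h : f ∈ S) : m f ∈ spanOn A m S :=
  Submodule.subset_span ⟨f, h, rfl⟩

theorem spanOn_le {m : G → E} {S : Set G} {N : Submodule A E} :
    spanOn A m S ≤ N ↔ ∀ f ∈ S, m f ∈ N := by
  rw [spanOn, Submodule.span_le, Set.image_subset_iff]
  rfl

theorem spanOn_mono {m : G → E} {S S' : Set G} (h : S ⊆ S') : spanOn A m S ≤ spanOn A m S' :=
  Submodule.span_mono (Set.image_mono h)

theorem mem_spanOn_singleton {m : G → E} {f : G} {x : E} :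
    x ∈ spanOn A m {f} ↔ ∃ a : A, a • m f = x := by
  rw [spanOn, Set.image_singleton, Submodule.mem_span_singleton]

theorem mem_spanOn_union {m : G → E} {S S' : Set G} {x : E} :
    x ∈ spanOn A m (S ∪ S') ↔ ∃ y ∈ spanOn A m S, ∃ z ∈ spanOn A m S', y + z = x := by
  rw [spanOn, Set.image_union, Submodule.span_union, Submodule.mem_sup, spanOn, spanOn]

end SpanOn

/-- The element `h` is the leading form of `x` in degree `γ`: it is homogeneous of degree `γ` and
`x - h` is a sum of terms of smaller degree. The form `h = 0` is allowed, so that leading forms in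
a fixed degree are additive. -/
structure HasLeadingForm (A : Type*) {E G Γ : Type*} [Semiring A] [AddCommGroup E] [Module A E]
    [LT Γ] (m : G → E) (d : G → Γ) (γ : Γ) (h x : E) : Prop where
  mem : h ∈ spanOn A m {f | d f = γ}
  sub_mem : x - h ∈ spanOn A m {f | d f < γ}

/-- The leading form of `x` is a unit multiple of the member of index `f`. -/
def HasLeadingMonomial (A : Type*) {E G Γ : Type*} [Semiring A] [AddCommGroup E] [Module A E]
    [LT Γ] (m : G → E) (d : G → Γ) (f : G) (x : E) : Prop :=
  ∃ r : Aˣ, HasLeadingForm A m d (d f) ((r : A) • m f) x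

namespace HasLeadingForm

section Additive

variable {A E G Γ : Type*} [Ring A] [AddCommGroup E] [Module A E] [Preorder Γ]
variable {m : G → E} {d : G → Γ} {γ : Γ} {h k x y : E}

theorem of_mem (hh : h ∈ spanOn A m {f | d f = γ}) : HasLeadingForm A m d γ h h :=
  ⟨hh, by simp only [sub_self, Submodule.zero_mem]⟩

theorem zero_of_mem_lt (hx : x ∈ spanOn A m {f | d f < γ}) : HasLeadingForm A m d γ 0 x :=
  ⟨Submodule.zero_mem _, by rwa [sub_zero]⟩

theorem mem_lt_of_zero (hx : HasLeadingForm A m d γ 0 x) : x ∈ spanOn A m {f | d f < γ} := by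
  simpa only [sub_zero] using hx.sub_mem

theorem mem_le (hx : HasLeadingForm A m d γ h x) : x ∈ spanOn A m {f | d f ≤ γ} := by
  rw [← add_sub_cancel h x]
  exact Submodule.add_mem _ (spanOn_mono (fun _ hf => le_of_eq hf) hx.mem)
    (spanOn_mono (fun _ hf => le_of_lt hf) hx.sub_mem)

theorem add (hx : HasLeadingForm A m d γ h x) (hy : HasLeadingForm A m d γ k y) :
    HasLeadingForm A m d γ (h + k) (x + y) :=
  ⟨Submodule.add_mem _ hx.mem hy.mem, by
    rw [add_sub_add_comm]
    exact Submodule.add_mem _ hx.sub_mem hy.sub_mem⟩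

theorem sub (hx : HasLeadingForm A m d γ h x) (hy : HasLeadingForm A m d γ k y) :
    HasLeadingForm A m d γ (h - k) (x - y) :=
  ⟨Submodule.sub_mem _ hx.mem hy.mem, by
    rw [sub_sub_sub_comm]
    exact Submodule.sub_mem _ hx.sub_mem hy.sub_mem⟩

theorem eq_zero_of_mem (hm : LinearIndependent A m) (hx : HasLeadingForm A m d γ h x)
    {S : Set G} (hS : ∀ f ∈ S, d f ≠ γ) (hxS : x ∈ spanOn A m S) : h = 0 := by
  have hdisj : Disjoint {f | d f = γ} (S ∪ {f | d f < γ}) :=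
    Set.disjoint_left.2 fun f hf hf' => hf'.elim (fun hfS => hS f hfS hf) fun hlt => hlt.ne hf
  have hh : h ∈ spanOn A m (S ∪ {f | d f < γ}) := by
    rw [← sub_sub_self x h]
    exact Submodule.sub_mem _ (spanOn_mono Set.subset_union_left hxS)
      (spanOn_mono Set.subset_union_right hx.sub_mem)
  exact Submodule.disjoint_def.1 (hm.disjoint_span_image hdisj) h hx.mem hh

theorem exists_mem_eq (hm : LinearIndependent A m) (hx : HasLeadingForm A m d γ h x)
    (hh : h ≠ 0) {S : Set G} (hxS : x ∈ spanOn A m S) : ∃ f ∈ S, d f = γ := by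
  by_contra! hS
  exact hh (hx.eq_zero_of_mem hm hS hxS)

theorem unique (hm : LinearIndependent A m) (hx : HasLeadingForm A m d γ h x)
    (hy : HasLeadingForm A m d γ k x) : h = k := by
  have hzero : HasLeadingForm A m d γ (h - k) 0 := by simpa only [sub_self] using hx.sub hy
  exact sub_eq_zero.1 (hzero.eq_zero_of_mem hm (S := ∅) (by simp) (Submodule.zero_mem _))

theorem exists_smul_eq (hd : Function.Injective d) (hx : HasLeadingForm A m d γ h x)
    (hh : h ≠ 0) : ∃ f, d f = γ ∧ ∃ a : A, a • m f = h := by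
  by_cases hγ : ∃ f, d f = γ
  · obtain ⟨f, rfl⟩ := hγ
    exact ⟨f, rfl, mem_spanOn_singleton.1 (spanOn_mono (fun _ hg => hd hg) hx.mem)⟩
  · have hempty : {f | d f = γ} = ∅ := Set.eq_empty_of_forall_notMem fun f hf => hγ ⟨f, hf⟩
    have hmem := hx.mem
    rw [hempty, spanOn, Set.image_empty, Submodule.span_empty, Submodule.mem_bot] at hmem
    exact absurd hmem hh

end Additive

theorem smul {A E G Γ : Type*} [CommRing A] [AddCommGroup E] [Module A E] [LT Γ] {m : G → E}
    {d : G → Γ} {γ : Γ} {h x : E} (a : A) (hx : HasLeadingForm A m d γ h x) :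
    HasLeadingForm A m d γ (a • h) (a • x) :=
  ⟨Submodule.smul_mem _ _ hx.mem, by
    rw [← smul_sub]
    exact Submodule.smul_mem _ _ hx.sub_mem⟩

end HasLeadingForm

theorem exists_hasLeadingForm_of_mem_le {A E G Γ : Type*} [Ring A] [AddCommGroup E] [Module A E]
    [PartialOrder Γ] {m : G → E} {d : G → Γ} {γ : Γ} {x : E}
    (hx : x ∈ spanOn A m {f | d f ≤ γ}) : ∃ h, HasLeadingForm A m d γ h x := by
  obtain ⟨h, hh, y, hy, rfl⟩ := mem_spanOn_union.1
    (spanOn_mono (S' := {f | d f = γ} ∪ {f | d f < γ}) (fun _ hf => eq_or_lt_of_le hf) hx)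
  exact ⟨h, hh, by rwa [add_sub_cancel_left]⟩

theorem exists_hasLeadingForm {A E G Γ : Type*} [Ring A] [AddCommGroup E] [Module A E]
    [LinearOrder Γ] {m : G → E} (hm : LinearIndependent A m) (d : G → Γ) {x : E}
    (hx : x ∈ spanOn A m Set.univ) (hx0 : x ≠ 0) :
    ∃ γ h, h ≠ 0 ∧ HasLeadingForm A m d γ h x := by
  classical
  rw [spanOn, Finsupp.mem_span_image_iff_linearCombination] at hx
  obtain ⟨l, -, rfl⟩ := hx
  have hl : l.support.Nonempty := by
    rw [Finsupp.support_nonempty_iff]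
    rintro rfl
    exact hx0 (map_zero _)
  obtain ⟨f, hf, hmax⟩ := l.support.exists_max_image d hl
  have hlin {S : Set G} {l' : G →₀ A} (hl' : ∀ g ∈ l'.support, g ∈ S) :
      Finsupp.linearCombination A m l' ∈ spanOn A m S :=
    (Finsupp.mem_span_image_iff_linearCombination A).2 ⟨l', hl', rfl⟩
  refine ⟨d f, Finsupp.linearCombination A m (l.filter (d · = d f)), ?_, hlin ?_, ?_⟩
  · rw [← map_zero (Finsupp.linearCombination A m), hm.ne_iff]
    intro h0
    have hf0 := DFunLike.congr_fun h0 f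
    rw [Finsupp.filter_apply_pos (d · = d f) l rfl] at hf0
    exact Finsupp.mem_support_iff.1 hf hf0
  · intro g hg
    rw [Finsupp.support_filter, Finset.mem_filter] at hg
    exact hg.2
  · conv in Finsupp.linearCombination A m l => rw [← l.filter_add_filter_not (d · = d f)]
    rw [map_add, add_sub_cancel_left]
    refine hlin fun g hg => ?_
    rw [Finsupp.support_filter, Finset.mem_filter] at hg
    exact lt_of_le_of_ne (hmax g hg.1) hg.2

theorem linearIndependent_of_hasLeadingMonomial {A E G Γ ι : Type*} [CommRing A]
    [AddCommGroup E] [Module A E] [LinearOrder Γ] {m : G → E} (hm : LinearIndependent A m)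
    {d : G → Γ} {e : ι → G} (hde : Function.Injective (d ∘ e)) {b : ι → E}
    (hb : ∀ i, HasLeadingMonomial A m d (e i) (b i)) : LinearIndependent A b := by
  classical
  choose r hr using hb
  rw [linearIndependent_iff']
  intro s g hg
  by_contra! hne
  obtain ⟨i, hi, hgi⟩ := hne
  obtain ⟨j, hj, hmax⟩ := (s.filter fun i => g i ≠ 0).exists_max_image (d ∘ e)
    ⟨i, Finset.mem_filter.2 ⟨hi, hgi⟩⟩
  rw [Finset.mem_filter] at hj
  have hrest : ∑ i ∈ s.erase j, g i • b i ∈ spanOn A m {f | d f < d (e j)} := by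
    refine Submodule.sum_mem _ fun i hi => ?_
    obtain ⟨hij, his⟩ := Finset.mem_erase.1 hi
    by_cases h0 : g i = 0
    · rw [h0, zero_smul]
      exact Submodule.zero_mem _
    · have hlt : d (e i) < d (e j) :=
        lt_of_le_of_ne (hmax i (Finset.mem_filter.2 ⟨his, h0⟩)) (hde.ne hij)
      exact Submodule.smul_mem _ _ (spanOn_mono (fun f hf => lt_of_le_of_lt hf hlt) (hr i).mem_le)
  have hsum := ((hr j).smul (g j)).add (HasLeadingForm.zero_of_mem_lt hrest)
  rw [Finset.add_sum_erase s (fun i => g i • b i) hj.1, hg, add_zero, smul_smul] at hsum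
  have hzero := hsum.eq_zero_of_mem hm (S := ∅) (by simp) (Submodule.zero_mem _)
  exact hj.2 ((r j).isUnit.mul_left_eq_zero.1
    (hm.smul_left_injective (e j) (hzero.trans (zero_smul A _).symm)))

/-- The family `m` is an `A`-basis of a twisted group algebra inside `E`: it is linearly
independent, and multiplicative up to the units `c f g`. -/
structure IsTwistedBasis {A E G : Type*} [CommRing A] [Ring E] [Algebra A E] [AddMonoid G]
    (c : G → G → Aˣ) (m : G → E) : Prop where
  one : m 0 = 1
  mul : ∀ f g, m f * m g = (c f g : A) • m (f + g)
  linearIndependent : LinearIndependent A m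

namespace IsTwistedBasis

variable {A E G : Type*} [CommRing A] [Ring E] [Algebra A E] [AddMonoid G]
variable {c : G → G → Aˣ} {m : G → E}

theorem mul_mem (hm : IsTwistedBasis c m) {S S' U : Set G}
    (hU : ∀ f ∈ S, ∀ g ∈ S', f + g ∈ U) {x y : E}
    (hx : x ∈ spanOn A m S) (hy : y ∈ spanOn A m S') : x * y ∈ spanOn A m U := by
  refine Submodule.mul_le.1 (?_ : spanOn A m S * spanOn A m S' ≤ _) x hx y hy
  rw [spanOn, spanOn, Submodule.span_mul_span, Submodule.span_le]
  rintro _ ⟨_, ⟨f, hf, rfl⟩, _, ⟨g, hg, rfl⟩, rfl⟩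
  simp only [hm.mul]
  exact Submodule.smul_mem _ _ (mem_spanOn m (hU f hf g hg))

theorem exists_pow_eq (hm : IsTwistedBasis c m) (f : G) (n : ℕ) :
    ∃ r : Aˣ, m f ^ n = (r : A) • m (n • f) := by
  induction n with
  | zero => exact ⟨1, by rw [pow_zero, zero_smul, hm.one, Units.val_one, one_smul]⟩
  | succ n ih =>
    obtain ⟨r, hr⟩ := ih
    refine ⟨r * c (n • f) f, ?_⟩
    rw [pow_succ, hr, smul_mul_assoc, hm.mul, smul_smul, succ_nsmul, Units.val_mul]

end IsTwistedBasis

section Multiplicative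

variable {A E G Γ : Type*} [CommRing A] [Ring E] [Algebra A E] [AddMonoid G]
variable [AddCommMonoid Γ] [PartialOrder Γ] [IsOrderedCancelAddMonoid Γ]
variable {c : G → G → Aˣ} {m : G → E} {d : G →+ Γ} {x y : E}

theorem HasLeadingForm.mul (hm : IsTwistedBasis c m) {γ δ : Γ} {h k : E}
    (hx : HasLeadingForm A m d γ h x) (hy : HasLeadingForm A m d δ k y) :
    HasLeadingForm A m d (γ + δ) (h * k) (x * y) where
  mem := hm.mul_mem (fun f hf g hg => by
    rw [Set.mem_ofPred_eq, map_add, show d f = γ from hf, show d g = δ from hg]) hx.mem hy.mem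
  sub_mem := by
    have hsub : x * y - h * k = x * (y - k) + (x - h) * k := by noncomm_ring
    rw [hsub]
    refine Submodule.add_mem _ (hm.mul_mem ?_ hx.mem_le hy.sub_mem)
      (hm.mul_mem ?_ hx.sub_mem hy.mem)
    · intro f hf g hg
      rw [Set.mem_ofPred_eq, map_add]
      exact add_lt_add_of_le_of_lt hf hg
    · intro f hf g hg
      rw [Set.mem_ofPred_eq, map_add]
      exact add_lt_add_of_lt_of_le hf (le_of_eq hg)

theorem HasLeadingForm.exists_mul_sub_smul_mem_lt (hm : IsTwistedBasis c m) {f g : G} {a b : A}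
    (hab : a ∣ b) (hx : HasLeadingForm A m d (d f) (a • m f) x)
    (hxy : HasLeadingForm A m d (d f + d g) (b • m (f + g)) (x * y)) :
    ∃ r : A, x * (y - r • m g) ∈ spanOn A m {g' | d g' < d f + d g} := by
  obtain ⟨r, rfl⟩ := hab
  refine ⟨r * ((c f g)⁻¹ : Aˣ), HasLeadingForm.mem_lt_of_zero ?_⟩
  have hu := hx.mul hm (.of_mem (Submodule.smul_mem _ (r * ((c f g)⁻¹ : Aˣ)) (mem_spanOn m
    (rfl : g ∈ {g' | d g' = d g}))))
  rw [smul_mul_smul_comm, hm.mul, smul_smul] at hu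
  have hsub := hxy.sub hu
  rwa [mul_assoc a, mul_assoc r, Units.inv_mul, mul_one, sub_self, ← mul_sub] at hsub

namespace HasLeadingMonomial

theorem mul (hm : IsTwistedBasis c m) {f g : G} (hx : HasLeadingMonomial A m d f x)
    (hy : HasLeadingMonomial A m d g y) : HasLeadingMonomial A m d (f + g) (x * y) := by
  obtain ⟨r, hr⟩ := hx
  obtain ⟨s, hs⟩ := hy
  refine ⟨r * s * c f g, ?_⟩
  have hrs := hr.mul hm hs
  rwa [smul_mul_smul_comm, hm.mul, smul_smul, ← map_add, ← Units.val_mul, ← Units.val_mul] at hrs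

theorem pow (hm : IsTwistedBasis c m) {f : G} (hx : HasLeadingMonomial A m d f x) (n : ℕ) :
    HasLeadingMonomial A m d (n • f) (x ^ n) := by
  induction n with
  | zero =>
    refine ⟨1, ?_⟩
    rw [Units.val_one, one_smul, zero_smul, hm.one, pow_zero]
    exact .of_mem (hm.one ▸ mem_spanOn m rfl)
  | succ n ih =>
    rw [pow_succ, succ_nsmul]
    exact ih.mul hm hx

end HasLeadingMonomial

end Multiplicative

theorem HasLeadingForm.of_mul {A E G Γ : Type*} [CommRing A] [Ring E] [NoZeroDivisors E]
    [Algebra A E] [AddMonoid G] [AddCommMonoid Γ] [LinearOrder Γ] [IsOrderedCancelAddMonoid Γ]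
    {c : G → G → Aˣ} {m : G → E} {d : G →+ Γ} (hm : IsTwistedBasis c m) {γ δ : Γ} {g h x y : E}
    (hx : HasLeadingForm A m d γ g x) (hg : g ≠ 0) (hy : y ∈ spanOn A m Set.univ)
    (hxy : HasLeadingForm A m d (γ + δ) h (x * y)) :
    ∃ k, HasLeadingForm A m d δ k y ∧ g * k = h := by
  have of_lead {k : E} (hk : HasLeadingForm A m d δ k y) :
      ∃ k, HasLeadingForm A m d δ k y ∧ g * k = h :=
    ⟨k, hk, (hx.mul hm hk).unique hm.linearIndependent hxy⟩
  rcases eq_or_ne y 0 with rfl | hy0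
  · exact of_lead (.zero_of_mem_lt (Submodule.zero_mem _))
  obtain ⟨δ', k, hk, hyk⟩ := exists_hasLeadingForm hm.linearIndependent d hy hy0
  rcases lt_trichotomy δ' δ with hlt | rfl | hlt
  · exact of_lead (.zero_of_mem_lt (spanOn_mono (fun f hf => lt_of_le_of_lt hf hlt) hyk.mem_le))
  · exact of_lead hyk
  · obtain ⟨f, hf, hf'⟩ := (hx.mul hm hyk).exists_mem_eq hm.linearIndependent (mul_ne_zero hg hk)
      hxy.mem_le
    exact absurd (hf'.symm.trans_le hf) (not_le.2 (by gcongr))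

/-! ## The presented algebra -/

section Relations

variable {A E : Type*} [CommRing A] [Ring E] [Algebra A E]

/-- Four elements of an algebra that satisfy the defining relations of the presented algebra. -/
structure A2Relations (q : Aˣ) (x1 x2 y1 y2 : E) : Prop where
  x2x1 : x2 * x1 = ((q ^ (-2 : ℤ) : Aˣ) : A) • (x1 * x2)
  y2x1 : y2 * x1 = ((q ^ (2 : ℤ) : Aˣ) : A) • (x1 * y2)
  x2y1 : x2 * y1 = ((q ^ (2 : ℤ) : Aˣ) : A) • (y1 * x2)
  x1y1 : x1 * y1 = 1 + (q : A) • x2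
  y1x1 : y1 * x1 = 1 + ((q⁻¹ : Aˣ) : A) • x2
  x2y2 : x2 * y2 = 1 + ((q⁻¹ : Aˣ) : A) • x1
  y2x2 : y2 * x2 = 1 + (q : A) • x1
  y2y1 : y2 * y1 = ((q ^ (-2 : ℤ) : Aˣ) : A) • (y1 * y2) +
    algebraMap A E (1 - ((q ^ (-2 : ℤ) : Aˣ) : A))

theorem mul_pow_of_mul_eq_smul {x y : E} {s : A} (h : x * y = s • (y * x)) (n : ℕ) :
    x * y ^ n = s ^ n • (y ^ n * x) := by
  induction n with
  | zero => simp
  | succ n ih =>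
    rw [pow_succ, ← mul_assoc, ih, smul_mul_assoc, mul_assoc, h, mul_smul_comm, smul_smul,
      ← pow_succ, ← mul_assoc]

theorem pow_mul_of_mul_eq_smul {x y : E} {s : A} (h : x * y = s • (y * x)) (n : ℕ) :
    x ^ n * y = s ^ n • (y * x ^ n) := by
  induction n with
  | zero => simp
  | succ n ih =>
    rw [pow_succ, mul_assoc, h, mul_smul_comm, ← mul_assoc, ih, smul_mul_assoc, smul_smul,
      mul_assoc, ← pow_succ']

theorem gen_relations (q : Aˣ) :
    A2Relations q (gen q Gen.x1) (gen q Gen.x2) (gen q Gen.y1) (gen q Gen.y2) := by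
  constructor
  · simpa [gen] using RingQuot.mkAlgHom_rel A (Rel.x2x1 (q := q))
  · simpa [gen] using RingQuot.mkAlgHom_rel A (Rel.y2x1 (q := q))
  · simpa [gen] using RingQuot.mkAlgHom_rel A (Rel.x2y1 (q := q))
  · simpa [gen] using RingQuot.mkAlgHom_rel A (Rel.x1y1 (q := q))
  · simpa [gen] using RingQuot.mkAlgHom_rel A (Rel.y1x1 (q := q))
  · simpa [gen] using RingQuot.mkAlgHom_rel A (Rel.x2y2 (q := q))
  · simpa [gen] using RingQuot.mkAlgHom_rel A (Rel.y2x2 (q := q))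
  · have := RingQuot.mkAlgHom_rel A (Rel.y2y1 (q := q))
    simpa only [gen, map_mul, map_add, map_smul, AlgHom.commutes] using this

theorem adjoin_gen (q : Aˣ) : Algebra.adjoin A
    {gen q Gen.x1, gen q Gen.x2, gen q Gen.y1, gen q Gen.y2} = ⊤ := by
  have h1 : Set.range (gen q : Gen → PresentedAlgebra q) =
      {gen q Gen.x1, gen q Gen.x2, gen q Gen.y1, gen q Gen.y2} := by
    ext x
    constructor
    · rintro ⟨g, rfl⟩
      cases g <;> simp
    · rintro (rfl | rfl | rfl | rfl) <;> exact ⟨_, rfl⟩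
  have h2 : Set.range (gen q : Gen → PresentedAlgebra q) =
      RingQuot.mkAlgHom A (Rel q) '' Set.range (FreeAlgebra.ι A) := by
    rw [← Set.range_comp]
    rfl
  rw [← h1, h2, ← AlgHom.map_adjoin, FreeAlgebra.adjoin_range_ι, Algebra.map_top,
    (AlgHom.range_eq_top _).2 (RingQuot.mkAlgHom_surjective A (Rel q))]

namespace A2Relations

variable {q : Aˣ} {x1 x2 y1 y2 : E}

/-- The homomorphism from the presented algebra given by elements that satisfy its relations. -/
noncomputable def toHom (h : A2Relations q x1 x2 y1 y2) : PresentedAlgebra q →ₐ[A] E :=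
  RingQuot.liftAlgHom A ⟨FreeAlgebra.lift A fun g => match g with
      | Gen.x1 => x1
      | Gen.x2 => x2
      | Gen.y1 => y1
      | Gen.y2 => y2, by
    intro a b hab
    cases hab
    · simpa using h.x2x1
    · simpa using h.y2x1
    · simpa using h.x2y1
    · simpa using h.x1y1
    · simpa using h.y1x1
    · simpa using h.x2y2
    · simpa using h.y2x2
    · simpa only [map_mul, map_add, map_smul, AlgHom.commutes, FreeAlgebra.lift_ι_apply]
        using h.y2y1⟩

theorem toHom_x1 (h : A2Relations q x1 x2 y1 y2) : h.toHom (gen q Gen.x1) = x1 := by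
  simp [toHom, gen]

theorem toHom_x2 (h : A2Relations q x1 x2 y1 y2) : h.toHom (gen q Gen.x2) = x2 := by
  simp [toHom, gen]

theorem toHom_y1 (h : A2Relations q x1 x2 y1 y2) : h.toHom (gen q Gen.y1) = y1 := by
  simp [toHom, gen]

theorem toHom_y2 (h : A2Relations q x1 x2 y1 y2) : h.toHom (gen q Gen.y2) = y2 := by
  simp [toHom, gen]

theorem range_toHom (h : A2Relations q x1 x2 y1 y2) :
    h.toHom.range = Algebra.adjoin A {x1, x2, y1, y2} := by
  rw [← Algebra.map_top, ← adjoin_gen, AlgHom.map_adjoin]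
  simp only [Set.image_insert_eq, Set.image_singleton, toHom_x1, toHom_x2, toHom_y1, toHom_y2]

theorem toHom_pbwMonomial (h : A2Relations q x1 x2 y1 y2) (p : PBWIndex) :
    h.toHom (pbwMonomial (gen q Gen.x1) (gen q Gen.x2) (gen q Gen.y1) (gen q Gen.y2) p) =
      pbwMonomial x1 x2 y1 y2 p := by
  simp only [pbwMonomial, map_mul, map_pow, toHom_x1, toHom_x2, toHom_y1, toHom_y2]

/-- The monomial `y₁ᵃ x₁ᵇ x₂ᶜ y₂ᵈ`, without the conditions on the exponents in `pbwMonomial`. -/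
def word {T : Type*} [Monoid T] (x1 x2 y1 y2 : T) (a b c d : ℕ) : T :=
  y1 ^ a * x1 ^ b * x2 ^ c * y2 ^ d

theorem word_succ_right (h : A2Relations q x1 x2 y1 y2) (a b c d : ℕ) :
    word x1 x2 y1 y2 a b (c + 1) (d + 1) = word x1 x2 y1 y2 a b c d +
      (((q⁻¹ : Aˣ) : A) * ((q ^ (-2 : ℤ) : Aˣ) : A) ^ c) •
        word x1 x2 y1 y2 a (b + 1) c d := by
  calc y1 ^ a * x1 ^ b * x2 ^ (c + 1) * y2 ^ (d + 1)
      = y1 ^ a * x1 ^ b * (x2 ^ c * (x2 * y2) * y2 ^ d) := by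
        rw [pow_succ x2, pow_succ' y2]
        simp only [mul_assoc]
    _ = y1 ^ a * x1 ^ b * (x2 ^ c * y2 ^ d) +
        ((q⁻¹ : Aˣ) : A) • (y1 ^ a * x1 ^ b * ((x2 ^ c * x1) * y2 ^ d)) := by
        rw [h.x2y2]
        simp only [mul_add, add_mul, mul_one, mul_smul_comm, smul_mul_assoc]
    _ = _ := by
        rw [pow_mul_of_mul_eq_smul h.x2x1, word, word, pow_succ x1]
        simp only [mul_smul_comm, smul_mul_assoc, mul_assoc, smul_smul]

theorem word_succ_left (h : A2Relations q x1 x2 y1 y2) (a b c d : ℕ) :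
    word x1 x2 y1 y2 (a + 1) (b + 1) c d = word x1 x2 y1 y2 a b c d +
      (((q⁻¹ : Aˣ) : A) * ((q ^ (-2 : ℤ) : Aˣ) : A) ^ b) •
        word x1 x2 y1 y2 a b (c + 1) d := by
  calc y1 ^ (a + 1) * x1 ^ (b + 1) * x2 ^ c * y2 ^ d
      = y1 ^ a * ((y1 * x1) * x1 ^ b) * x2 ^ c * y2 ^ d := by
        rw [pow_succ y1, pow_succ' x1]
        simp only [mul_assoc]
    _ = y1 ^ a * x1 ^ b * x2 ^ c * y2 ^ d +
        ((q⁻¹ : Aˣ) : A) • (y1 ^ a * (x2 * x1 ^ b) * x2 ^ c * y2 ^ d) := by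
        rw [h.y1x1]
        simp only [mul_add, add_mul, one_mul, mul_smul_comm, smul_mul_assoc]
    _ = _ := by
        rw [mul_pow_of_mul_eq_smul h.x2x1, word, word, pow_succ' x2]
        simp only [mul_smul_comm, smul_mul_assoc, mul_assoc, smul_smul]

theorem word_mem_span (h : A2Relations q x1 x2 y1 y2) (a b c d : ℕ) :
    word x1 x2 y1 y2 a b c d ∈ Submodule.span A (Set.range (pbwMonomial x1 x2 y1 y2)) := by
  induction hn : a + b + c + d using Nat.strong_induction_on generalizing a b c d with
  | h n ih =>
    by_cases hab : min a b = 0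
    · by_cases hdc : min d c = 0
      · exact Submodule.subset_span ⟨⟨(a, b, c, d), hab, hdc⟩, rfl⟩
      · obtain ⟨c, rfl⟩ := Nat.exists_eq_succ_of_ne_zero (n := c) (by lia)
        obtain ⟨d, rfl⟩ := Nat.exists_eq_succ_of_ne_zero (n := d) (by lia)
        rw [h.word_succ_right]
        exact Submodule.add_mem _ (ih _ (by lia) _ _ _ _ rfl)
          (Submodule.smul_mem _ _ (ih _ (by lia) _ _ _ _ rfl))
    · obtain ⟨a, rfl⟩ := Nat.exists_eq_succ_of_ne_zero (n := a) (by lia)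
      obtain ⟨b, rfl⟩ := Nat.exists_eq_succ_of_ne_zero (n := b) (by lia)
      rw [h.word_succ_left]
      exact Submodule.add_mem _ (ih _ (by lia) _ _ _ _ rfl)
        (Submodule.smul_mem _ _ (ih _ (by lia) _ _ _ _ rfl))

theorem y1_mul_word (a b c d : ℕ) :
    y1 * word x1 x2 y1 y2 a b c d = word x1 x2 y1 y2 (a + 1) b c d := by
  simp only [word, pow_succ', mul_assoc]

theorem x2_mul_word (h : A2Relations q x1 x2 y1 y2) (a b c d : ℕ) :
    x2 * word x1 x2 y1 y2 a b c d =
      (((q ^ (2 : ℤ) : Aˣ) : A) ^ a * ((q ^ (-2 : ℤ) : Aˣ) : A) ^ b) •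
        word x1 x2 y1 y2 a b (c + 1) d := by
  calc x2 * (y1 ^ a * x1 ^ b * x2 ^ c * y2 ^ d)
      = (x2 * y1 ^ a) * (x1 ^ b * x2 ^ c * y2 ^ d) := by simp only [mul_assoc]
    _ = ((q ^ (2 : ℤ) : Aˣ) : A) ^ a • (y1 ^ a * (x2 * x1 ^ b) * (x2 ^ c * y2 ^ d)) := by
        rw [mul_pow_of_mul_eq_smul h.x2y1]
        simp only [smul_mul_assoc, mul_assoc]
    _ = _ := by
        rw [mul_pow_of_mul_eq_smul h.x2x1, word, pow_succ' x2]
        simp only [mul_smul_comm, smul_mul_assoc, mul_assoc, smul_smul]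

theorem x1_mul_word_zero (b c d : ℕ) :
    x1 * word x1 x2 y1 y2 0 b c d = word x1 x2 y1 y2 0 (b + 1) c d := by
  simp only [word, pow_zero, one_mul, pow_succ', mul_assoc]

theorem x1_mul_word_succ (h : A2Relations q x1 x2 y1 y2) (a b c d : ℕ) :
    x1 * word x1 x2 y1 y2 (a + 1) b c d =
      word x1 x2 y1 y2 a b c d + (q : A) • (x2 * word x1 x2 y1 y2 a b c d) := by
  rw [← y1_mul_word, ← mul_assoc, h.x1y1, add_mul, one_mul, smul_mul_assoc]

theorem y2_mul_word_succ (h : A2Relations q x1 x2 y1 y2) (a b c d : ℕ) :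
    y2 * word x1 x2 y1 y2 (a + 1) b c d =
      ((q ^ (-2 : ℤ) : Aˣ) : A) • (y1 * (y2 * word x1 x2 y1 y2 a b c d)) +
        (1 - ((q ^ (-2 : ℤ) : Aˣ) : A)) • word x1 x2 y1 y2 a b c d := by
  rw [← y1_mul_word, ← mul_assoc, h.y2y1, add_mul, smul_mul_assoc, mul_assoc, ← Algebra.smul_def]

theorem y2_mul_word_zero_zero (h : A2Relations q x1 x2 y1 y2) (b d : ℕ) :
    y2 * word x1 x2 y1 y2 0 b 0 d =
      ((q ^ (2 : ℤ) : Aˣ) : A) ^ b • word x1 x2 y1 y2 0 b 0 (d + 1) := by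
  simp only [word, pow_zero, one_mul, mul_one]
  rw [← mul_assoc, mul_pow_of_mul_eq_smul h.y2x1, smul_mul_assoc, mul_assoc, ← pow_succ']

theorem y2_mul_word_zero_succ (h : A2Relations q x1 x2 y1 y2) (b c d : ℕ) :
    y2 * word x1 x2 y1 y2 0 b (c + 1) d = ((q ^ (2 : ℤ) : Aˣ) : A) ^ b •
      (word x1 x2 y1 y2 0 b c d + (q : A) • word x1 x2 y1 y2 0 (b + 1) c d) := by
  calc y2 * (y1 ^ 0 * x1 ^ b * x2 ^ (c + 1) * y2 ^ d)
      = (y2 * x1 ^ b) * (x2 ^ (c + 1) * y2 ^ d) := by simp only [pow_zero, one_mul, mul_assoc]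
    _ = ((q ^ (2 : ℤ) : Aˣ) : A) ^ b • (x1 ^ b * (y2 * x2) * (x2 ^ c * y2 ^ d)) := by
        rw [mul_pow_of_mul_eq_smul h.y2x1, pow_succ']
        simp only [smul_mul_assoc, mul_assoc]
    _ = _ := by
        rw [h.y2x2, word, word, pow_succ x1]
        simp only [add_mul, mul_add, one_mul, mul_one, pow_zero, smul_mul_assoc, mul_smul_comm,
          mul_assoc]

theorem mul_mem_span {x y : E} (hx : ∀ a b c d : ℕ, x * word x1 x2 y1 y2 a b c d ∈
      Submodule.span A (Set.range (pbwMonomial x1 x2 y1 y2)))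
    (hy : y ∈ Submodule.span A (Set.range (pbwMonomial x1 x2 y1 y2))) :
    x * y ∈ Submodule.span A (Set.range (pbwMonomial x1 x2 y1 y2)) := by
  induction hy using Submodule.span_induction with
  | mem _ hp =>
    obtain ⟨p, rfl⟩ := hp
    exact hx _ _ _ _
  | zero => exact (mul_zero x).symm ▸ Submodule.zero_mem _
  | add y z _ _ ihy ihz => exact (mul_add x y z).symm ▸ Submodule.add_mem _ ihy ihz
  | smul r y _ ih => exact (mul_smul_comm r x y).symm ▸ Submodule.smul_mem _ r ih

theorem x1_mul_word_mem (h : A2Relations q x1 x2 y1 y2) (a b c d : ℕ) :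
    x1 * word x1 x2 y1 y2 a b c d ∈
      Submodule.span A (Set.range (pbwMonomial x1 x2 y1 y2)) := by
  cases a with
  | zero =>
    rw [x1_mul_word_zero]
    exact h.word_mem_span _ _ _ _
  | succ a =>
    rw [h.x1_mul_word_succ, h.x2_mul_word, smul_smul]
    exact Submodule.add_mem _ (h.word_mem_span _ _ _ _)
      (Submodule.smul_mem _ _ (h.word_mem_span _ _ _ _))

theorem y2_mul_word_mem (h : A2Relations q x1 x2 y1 y2) (a b c d : ℕ) :
    y2 * word x1 x2 y1 y2 a b c d ∈
      Submodule.span A (Set.range (pbwMonomial x1 x2 y1 y2)) := by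
  induction a with
  | zero =>
    cases c with
    | zero =>
      rw [h.y2_mul_word_zero_zero]
      exact Submodule.smul_mem _ _ (h.word_mem_span _ _ _ _)
    | succ c =>
      rw [h.y2_mul_word_zero_succ]
      exact Submodule.smul_mem _ _ (Submodule.add_mem _ (h.word_mem_span _ _ _ _)
        (Submodule.smul_mem _ _ (h.word_mem_span _ _ _ _)))
  | succ a ih =>
    rw [h.y2_mul_word_succ]
    refine Submodule.add_mem _ (Submodule.smul_mem _ _ (mul_mem_span (fun a b c d => ?_) ih))
      (Submodule.smul_mem _ _ (h.word_mem_span _ _ _ _))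
    rw [y1_mul_word]
    exact h.word_mem_span _ _ _ _

theorem span_pbwMonomial (h : A2Relations q x1 x2 y1 y2) :
    Submodule.span A (Set.range (pbwMonomial x1 x2 y1 y2)) =
      Subalgebra.toSubmodule (Algebra.adjoin A {x1, x2, y1, y2}) := by
  apply le_antisymm
  · rw [Submodule.span_le, Algebra.adjoin_eq_span]
    rintro _ ⟨p, rfl⟩
    have hgen {t : E} (ht : t ∈ ({x1, x2, y1, y2} : Set E)) (n : ℕ) :
        t ^ n ∈ Submonoid.closure {x1, x2, y1, y2} := pow_mem (Submonoid.subset_closure ht) n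
    exact Submodule.subset_span (mul_mem (mul_mem (mul_mem (hgen (by simp) _) (hgen (by simp) _))
      (hgen (by simp) _)) (hgen (by simp) _))
  · rw [Algebra.adjoin_eq_span, Submodule.span_le]
    intro w hw
    induction hw using Submonoid.closure_induction_left with
    | one => simpa only [word, pow_zero, mul_one, SetLike.mem_coe] using h.word_mem_span 0 0 0 0
    | mul_left t ht w _ ih =>
      refine mul_mem_span (fun a b c d => ?_) ih
      rcases ht with rfl | rfl | rfl | rfl
      · exact h.x1_mul_word_mem a b c d
      · rw [h.x2_mul_word]
        exact Submodule.smul_mem _ _ (h.word_mem_span _ _ _ _)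
      · rw [y1_mul_word]
        exact h.word_mem_span _ _ _ _
      · exact h.y2_mul_word_mem a b c d

end A2Relations

end Relations

/-! ## Bases of ordered monomials -/

section Torus

variable {A E : Type*} [CommRing A] [Ring E] [Algebra A E]

/-- The cocycle of the quantum torus of type `A₂`, with `q = ε^{1/2}`: the basis elements satisfy
`X^f X^g = ε^{Λ(f,g)/2} X^{f+g}`. -/
def torusCocycle (q : Aˣ) (f g : ℤ × ℤ) : Aˣ := q ^ (f.1 * g.2 - f.2 * g.1)

/-- The degree on `ℤ²` with values in `ℤ²` with the lexicographic order. -/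
def lexDegree : ℤ × ℤ →+ Lex (ℤ × ℤ) := (toLexAddEquiv (ℤ × ℤ)).toAddMonoidHom

theorem lexDegree_injective : Function.Injective lexDegree := toLex.injective

/-- The element `X^f` of the quantum torus of type `A₂`, acting on the group algebra of `ℤ²`. -/
noncomputable def twistedTranslation (q : Aˣ) (f : ℤ × ℤ) : Module.End A ((ℤ × ℤ) →₀ A) :=
  Finsupp.linearCombination A fun g => (torusCocycle q f g : A) • Finsupp.single (f + g) (1 : A)

theorem twistedTranslation_single (q : Aˣ) (f g : ℤ × ℤ) :
    twistedTranslation q f (Finsupp.single g 1) =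
      (torusCocycle q f g : A) • Finsupp.single (f + g) (1 : A) := by
  rw [twistedTranslation, Finsupp.linearCombination_single, one_smul]

theorem isTwistedBasis_twistedTranslation (q : Aˣ) :
    IsTwistedBasis (torusCocycle q) (twistedTranslation q) where
  one := by
    refine Finsupp.lhom_ext' fun g => LinearMap.ext_ring ?_
    simp [twistedTranslation_single, torusCocycle]
  mul f g := by
    refine Finsupp.lhom_ext' fun h => LinearMap.ext_ring ?_
    simp only [LinearMap.comp_apply, Finsupp.lsingle_apply, Module.End.mul_apply,
      LinearMap.smul_apply, twistedTranslation_single, map_smul, smul_smul, ← Units.val_mul,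
      torusCocycle, ← zpow_add, add_assoc, Prod.fst_add, Prod.snd_add]
    congr 3
    ring
  linearIndependent := by
    refine .of_comp (LinearMap.applyₗ (Finsupp.single (0 : ℤ × ℤ) (1 : A))) ?_
    have hcomp : LinearMap.applyₗ (Finsupp.single (0 : ℤ × ℤ) (1 : A)) ∘ twistedTranslation q =
        fun f => Finsupp.single f (1 : A) := by
      ext1 f
      simp [twistedTranslation_single, torusCocycle]
    exact hcomp ▸ Finsupp.linearIndependent_single_one A (ℤ × ℤ)

namespace IsTwistedBasis

variable {q : Aˣ} {m : ℤ × ℤ → E}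

theorem mul_mk_mk (hm : IsTwistedBasis (torusCocycle q) m) (a b c d : ℤ) :
    m (a, b) * m (c, d) = ((q ^ (a * d - b * c) : Aˣ) : A) • m (a + c, b + d) :=
  hm.mul (a, b) (c, d)

theorem mk_zero_zero (hm : IsTwistedBasis (torusCocycle q) m) : m (0, 0) = 1 :=
  hm.one

theorem a2Relations (hm : IsTwistedBasis (torusCocycle q) m) :
    A2Relations q (m (1, 0)) (m (0, 1)) (m (-1, 1) + m (-1, 0)) (m (1, -1) + m (0, -1)) where
  x2x1 := by
    simp only [hm.mul_mk_mk, smul_smul, ← Units.val_mul, ← zpow_add]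
    norm_num
  y2x1 := by
    simp only [hm.mul_mk_mk, add_mul, mul_add, smul_add, smul_smul, ← Units.val_mul, ← zpow_add]
    norm_num
  x2y1 := by
    simp only [hm.mul_mk_mk, add_mul, mul_add, smul_add, smul_smul, ← Units.val_mul, ← zpow_add]
    norm_num
  x1y1 := by
    simp only [hm.mul_mk_mk, mul_add]
    norm_num [hm.mk_zero_zero, add_comm]
  y1x1 := by
    simp only [hm.mul_mk_mk, add_mul]
    norm_num [hm.mk_zero_zero, add_comm]
  x2y2 := by
    simp only [hm.mul_mk_mk, mul_add]
    norm_num [hm.mk_zero_zero, add_comm]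
  y2x2 := by
    simp only [hm.mul_mk_mk, add_mul]
    norm_num [hm.mk_zero_zero, add_comm]
  y2y1 := by
    simp only [hm.mul_mk_mk, add_mul, mul_add, smul_add, smul_smul, ← Units.val_mul, ← zpow_add,
      Algebra.algebraMap_eq_smul_one, sub_smul, one_smul]
    norm_num [hm.mk_zero_zero]
    abel

theorem linearIndependent_pbwMonomial (hm : IsTwistedBasis (torusCocycle q) m) :
    LinearIndependent A (pbwMonomial (m (1, 0)) (m (0, 1)) (m (-1, 1) + m (-1, 0))
      (m (1, -1) + m (0, -1))) := by
  have lead_add (f g : ℤ × ℤ) (hgf : lexDegree f < lexDegree g) :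
      HasLeadingMonomial A m (-lexDegree) f (m g + m f) := by
    refine ⟨1, ?_, ?_⟩
    · exact Submodule.smul_mem _ _ (mem_spanOn m rfl)
    · rw [Units.val_one, one_smul, add_sub_cancel_right]
      exact mem_spanOn m (neg_lt_neg hgf)
  have lead_self (f : ℤ × ℤ) : HasLeadingMonomial A m (-lexDegree) f (m f) :=
    ⟨1, by rw [Units.val_one, one_smul]; exact .of_mem (mem_spanOn m rfl)⟩
  have lead_y1 := lead_add (-1, 0) (-1, 1) (Prod.Lex.toLex_lt_toLex.2 (by norm_num))
  have lead_y2 := lead_add (0, -1) (1, -1) (Prod.Lex.toLex_lt_toLex.2 (by norm_num))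
  refine linearIndependent_of_hasLeadingMonomial hm.linearIndependent (d := -lexDegree)
    (e := fun p => ((p.1.2.1 : ℤ) - p.1.1, (p.1.2.2.1 : ℤ) - p.1.2.2.2)) ?_ fun p => ?_
  · refine (neg_injective.comp lexDegree_injective).comp ?_
    rintro ⟨⟨a, b, c, d⟩, h1, h2⟩ ⟨⟨a', b', c', d'⟩, h3, h4⟩ he
    simp only [Prod.mk.injEq] at he h1 h2 h3 h4
    simp only [Subtype.mk.injEq, Prod.mk.injEq]
    lia
  · have hlead := (((lead_y1.pow hm p.1.1).mul hm ((lead_self (1, 0)).pow hm p.1.2.1)).mul hm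
      ((lead_self (0, 1)).pow hm p.1.2.2.1)).mul hm (lead_y2.pow hm p.1.2.2.2)
    convert hlead using 1
    · ext <;> simp <;> ring
    · rfl

end IsTwistedBasis

/-- The basis of ordered monomials of the presented algebra. -/
noncomputable def pbwBasis (q : Aˣ) : Module.Basis PBWIndex A (PresentedAlgebra q) :=
  .mk (v := pbwMonomial (gen q Gen.x1) (gen q Gen.x2) (gen q Gen.y1) (gen q Gen.y2))
    (by
      have htorus := isTwistedBasis_twistedTranslation q
      refine .of_comp htorus.a2Relations.toHom.toLinearMap ?_
      convert htorus.linearIndependent_pbwMonomial using 1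
      exact funext htorus.a2Relations.toHom_pbwMonomial)
    (by rw [(gen_relations q).span_pbwMonomial, adjoin_gen, Algebra.top_toSubmodule])

theorem pbwBasis_apply (q : Aˣ) (p : PBWIndex) : pbwBasis q p =
    pbwMonomial (gen q Gen.x1) (gen q Gen.x2) (gen q Gen.y1) (gen q Gen.y2) p :=
  Module.Basis.mk_apply _ _ _

theorem A2Relations.toHom_injective {q : Aˣ} {x1 x2 y1 y2 : E} (h : A2Relations q x1 x2 y1 y2)
    (hli : LinearIndependent A (pbwMonomial x1 x2 y1 y2)) : Function.Injective h.toHom := by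
  refine LinearMap.injective_of_linearIndependent (f := h.toHom.toLinearMap) (pbwBasis q).span_eq ?_
  have hcomp : h.toHom.toLinearMap ∘ pbwBasis q = pbwMonomial x1 x2 y1 y2 := funext fun p => by
    rw [Function.comp_apply, pbwBasis_apply, AlgHom.toLinearMap_apply, h.toHom_pbwMonomial]
  rwa [hcomp]

end Torus

/-! ## Pairs of quasi-commuting elements -/

section Pairs

variable {A : Type*} [CommRing A] {F : Type*} [DivisionRing F] [Algebra A F]

theorem units_smul_zpow (s : Aˣ) (y : F) (n : ℤ) :
    ((s : A) • y) ^ n = ((s ^ n : Aˣ) : A) • y ^ n := by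
  have hval (t : Aˣ) : algebraMap A F t = (Units.map (algebraMap A F : A →* F) t : F) := rfl
  have hcomm : Commute (algebraMap A F s) y := Algebra.commutes _ _
  rw [Algebra.smul_def, hcomm.mul_zpow, Algebra.smul_def, hval, hval, map_zpow,
    Units.val_zpow_eq_zpow_val]

theorem mul_zpow_of_mul_eq_smul {x y : F} {s : Aˣ} (h : x * y = (s : A) • (y * x)) (n : ℤ) :
    x * y ^ n = ((s ^ n : Aˣ) : A) • (y ^ n * x) := by
  have hsemi : SemiconjBy x y ((s : A) • y) := by rwa [SemiconjBy, smul_mul_assoc]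
  rw [(hsemi.zpow_right₀ n).eq, units_smul_zpow, smul_mul_assoc]

theorem mul_eq_smul_comm {E : Type*} [Ring E] [Algebra A E] {x y : E} {s : Aˣ} :
    x * y = (s : A) • (y * x) ↔ y * x = ((s⁻¹ : Aˣ) : A) • (x * y) := by
  rw [← Units.smul_def, ← Units.smul_def, eq_inv_smul_iff, eq_comm]

/-- The monomials `u^i v^j` in a pair of elements of a division ring. -/
def mon (u v : F) (p : ℤ × ℤ) : F := u ^ p.1 * v ^ p.2

/-- The algebra of Laurent polynomials in a pair of elements of a division ring. -/
def pairTorus (A : Type*) [CommRing A] [Algebra A F] (u v : F) : Subalgebra A F :=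
  Algebra.adjoin A {u, u⁻¹, v, v⁻¹}

theorem pairTorus_le {u v : F} {B : Subalgebra A F} :
    pairTorus A u v ≤ B ↔ u ∈ B ∧ u⁻¹ ∈ B ∧ v ∈ B ∧ v⁻¹ ∈ B := by
  simp only [pairTorus, Algebra.adjoin_le_iff, Set.insert_subset_iff, Set.singleton_subset_iff,
    SetLike.mem_coe]

theorem pairTorus_comm (u v : F) : pairTorus A u v = pairTorus A v u := by
  rw [pairTorus, pairTorus]
  congr 1
  ext
  simp only [Set.mem_insert_iff, Set.mem_singleton_iff]
  tauto

theorem zpow_mem_of_inv_mem {B : Subalgebra A F} {u : F} (hu : u ∈ B) (hu' : u⁻¹ ∈ B) (n : ℤ) :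
    u ^ n ∈ B := by
  cases n with
  | ofNat n => simpa only [Int.ofNat_eq_natCast, zpow_natCast] using pow_mem hu n
  | negSucc n => simpa only [zpow_negSucc, inv_pow] using pow_mem hu' (n + 1)

theorem mon_mem_pairTorus (u v : F) (p : ℤ × ℤ) : mon u v p ∈ pairTorus A u v := by
  obtain ⟨hu, hu', hv, hv'⟩ := pairTorus_le.1 (le_refl (pairTorus A u v))
  exact mul_mem (zpow_mem_of_inv_mem hu hu' _) (zpow_mem_of_inv_mem hv hv' _)

/-- A pair of nonzero elements of a division ring that commute up to the unit `s`. -/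
structure QuasiComm (s : Aˣ) (u v : F) : Prop where
  left_ne_zero : u ≠ 0
  right_ne_zero : v ≠ 0
  mul_eq : u * v = (s : A) • (v * u)

namespace QuasiComm

variable {s : Aˣ} {u v : F}

theorem symm (h : QuasiComm s u v) : QuasiComm s⁻¹ v u :=
  ⟨h.right_ne_zero, h.left_ne_zero, mul_eq_smul_comm.1 h.mul_eq⟩

theorem zpow_mul_zpow (h : QuasiComm s u v) (i j : ℤ) :
    u ^ i * v ^ j = ((s ^ (i * j) : Aˣ) : A) • (v ^ j * u ^ i) := by
  have hi : u ^ i * v = ((s ^ i : Aˣ) : A) • (v * u ^ i) := by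
    rw [mul_eq_smul_comm, ← inv_zpow]
    exact mul_zpow_of_mul_eq_smul h.symm.mul_eq i
  rw [mul_zpow_of_mul_eq_smul hi j, zpow_mul]

theorem mon_mul (h : QuasiComm s u v) (f g : ℤ × ℤ) :
    mon u v f * mon u v g = ((s ^ (-(g.1 * f.2)) : Aˣ) : A) • mon u v (f + g) := by
  have hcomm : v ^ f.2 * u ^ g.1 = ((s ^ (-(g.1 * f.2)) : Aˣ) : A) • (u ^ g.1 * v ^ f.2) := by
    rw [zpow_neg]
    exact mul_eq_smul_comm.1 (h.zpow_mul_zpow _ _)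
  calc mon u v f * mon u v g = u ^ f.1 * (v ^ f.2 * u ^ g.1) * v ^ g.2 := by
        simp only [mon, mul_assoc]
    _ = _ := by
        rw [hcomm, mon, Prod.fst_add, Prod.snd_add, zpow_add₀ h.left_ne_zero,
          zpow_add₀ h.right_ne_zero]
        simp only [mul_smul_comm, smul_mul_assoc, mul_assoc]

theorem isTwistedBasis (h : QuasiComm s u v) (hli : LinearIndependent A (mon u v)) :
    IsTwistedBasis (fun f g => s ^ (-(g.1 * f.2))) (mon u v) where
  one := by simp only [mon, Prod.fst_zero, Prod.snd_zero, zpow_zero, mul_one]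
  mul := h.mon_mul
  linearIndependent := hli

theorem spanOn_mon (h : QuasiComm s u v) :
    spanOn A (mon u v) Set.univ = Subalgebra.toSubmodule (pairTorus A u v) := by
  apply le_antisymm
  · exact spanOn_le.2 fun p _ => mon_mem_pairTorus u v p
  · have hmon (p : ℤ × ℤ) : mon u v p ∈ spanOn A (mon u v) Set.univ :=
      mem_spanOn _ (Set.mem_univ p)
    intro x hx
    induction hx using Algebra.adjoin_induction with
    | mem x hx =>
      rcases hx with rfl | rfl | rfl | rfl
      · simpa [mon] using hmon (1, 0)
      · simpa [mon] using hmon (-1, 0)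
      · simpa [mon] using hmon (0, 1)
      · simpa [mon] using hmon (0, -1)
    | algebraMap r =>
      rw [Algebra.algebraMap_eq_smul_one]
      exact Submodule.smul_mem _ _ (by simpa [mon] using hmon (0, 0))
    | add x y _ _ hx hy => exact Submodule.add_mem _ hx hy
    | mul x y _ _ hx hy =>
      refine Submodule.mul_le.1 (?_ : spanOn A (mon u v) Set.univ * spanOn A (mon u v) Set.univ ≤ _)
        x hx y hy
      rw [spanOn, Submodule.span_mul_span, Submodule.span_le]
      rintro _ ⟨_, ⟨f, -, rfl⟩, _, ⟨g, -, rfl⟩, rfl⟩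
      simp only [h.mon_mul]
      exact Submodule.smul_mem _ _ (hmon (f + g))

end QuasiComm

/-- The toric frame with values `u` and `v` at the standard basis vectors, where `u` and `v`
commute up to `t ^ 2`: the power of `t` turns `u ^ i * v ^ j` into the symmetric ordering. -/
def normFrame (t : Aˣ) (u v : F) : (Fin 2 → ℤ) → F := fun f =>
  ((t ^ (-(f 0 * f 1)) : Aˣ) : A) • (u ^ f 0 * v ^ f 1)

theorem normFrame_apply (t : Aˣ) (u v : F) (i j : ℤ) :
    normFrame t u v ![i, j] = ((t ^ (-(i * j)) : Aˣ) : A) • (u ^ i * v ^ j) := rfl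

theorem normFrame_stdVec_zero (t : Aˣ) (u v : F) : normFrame t u v (stdVec 0) = u := by
  simp [normFrame, stdVec]

theorem normFrame_stdVec_one (t : Aˣ) (u v : F) : normFrame t u v (stdVec 1) = v := by
  simp [normFrame, stdVec]

theorem quantumTorus_normFrame (t : Aˣ) (u v : F) :
    quantumTorus A (normFrame t u v) = pairTorus A u v := by
  apply le_antisymm
  · refine Algebra.adjoin_le ?_
    rintro _ ⟨f, rfl⟩
    exact Subalgebra.smul_mem _ (mon_mem_pairTorus u v (f 0, f 1)) _
  · have hframe (f : Fin 2 → ℤ) : normFrame t u v f ∈ quantumTorus A (normFrame t u v) :=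
      Algebra.subset_adjoin ⟨f, rfl⟩
    refine pairTorus_le.2 ⟨?_, ?_, ?_, ?_⟩
    · simpa [normFrame_apply] using hframe ![1, 0]
    · simpa [normFrame_apply] using hframe ![-1, 0]
    · simpa [normFrame_apply] using hframe ![0, 1]
    · simpa [normFrame_apply] using hframe ![0, -1]

end Pairs

/-! ## Seeds of type `A₂` -/

section Seeds

variable {A : Type*} [CommRing A] {F : Type*} [DivisionRing F] [Algebra A F] {ℓ : ℕ}

theorem epsPow_intCast {q : Aˣ} (hq : q ^ ℓ = 1) (n : ℤ) :
    epsPow q (n : ZMod ℓ) = ((q ^ n : Aˣ) : A) := by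
  rw [epsPow, ZMod.coe_intCast]
  congr 1
  conv_rhs =>
    rw [← Int.emod_add_mul_ediv n ℓ, zpow_add, zpow_mul, zpow_natCast, hq, one_zpow, mul_one]

/-- The seed of type `A₂` with cluster `(u, v)` and exchange matrix `s • exchA2`. Every mutation
reverses the sign `s`. -/
def signedSeed (ℓ : ℕ) (q : Aˣ) (s : ℤˣ) (u v : F) : Seed (Fin 2) ℓ F where
  frame := normFrame (q ^ (s : ℤ)) u v
  form := ((s : ℤ) : ZMod ℓ) • formA2 ℓ
  exch := (s : ℤ) • exchA2

theorem frame_signedSeed (q : Aˣ) (s : ℤˣ) (u v : F) :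
    (signedSeed ℓ q s u v).frame = normFrame (q ^ (s : ℤ)) u v := rfl

theorem newVar_zero_signedSeed (q : Aˣ) (s : ℤˣ) (u v : F) :
    newVar 0 (signedSeed ℓ q s u v) =
      normFrame (q ^ (s : ℤ)) u v ![-1, 1] + normFrame (q ^ (s : ℤ)) u v ![-1, 0] := by
  rcases Int.units_eq_one_or s with rfl | rfl
  · have hpos : posVec 0 (((1 : ℤˣ) : ℤ) • exchA2) = ![-1, 0] := by decide
    have hneg : negVec 0 (((1 : ℤˣ) : ℤ) • exchA2) = ![-1, 1] := by decide
    rw [newVar, signedSeed, hpos, hneg, add_comm]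
  · have hpos : posVec 0 (((-1 : ℤˣ) : ℤ) • exchA2) = ![-1, 1] := by decide
    have hneg : negVec 0 (((-1 : ℤˣ) : ℤ) • exchA2) = ![-1, 0] := by decide
    rw [newVar, signedSeed, hpos, hneg]

theorem newVar_one_signedSeed (q : Aˣ) (s : ℤˣ) (u v : F) :
    newVar 1 (signedSeed ℓ q s u v) =
      normFrame (q ^ (s : ℤ)) u v ![1, -1] + normFrame (q ^ (s : ℤ)) u v ![0, -1] := by
  rcases Int.units_eq_one_or s with rfl | rfl
  · have hpos : posVec 1 (((1 : ℤˣ) : ℤ) • exchA2) = ![1, -1] := by decide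
    have hneg : negVec 1 (((1 : ℤˣ) : ℤ) • exchA2) = ![0, -1] := by decide
    rw [newVar, signedSeed, hpos, hneg]
  · have hpos : posVec 1 (((-1 : ℤˣ) : ℤ) • exchA2) = ![0, -1] := by decide
    have hneg : negVec 1 (((-1 : ℤˣ) : ℤ) • exchA2) = ![1, -1] := by decide
    rw [newVar, signedSeed, hpos, hneg, add_comm]

theorem mutForm_signedSeed (q : Aˣ) (s : ℤˣ) (u v : F) (k : Fin 2) :
    mutForm k (signedSeed ℓ q s u v) = (((-s : ℤˣ) : ℤ) : ZMod ℓ) • formA2 ℓ := by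
  ext i j
  rcases Int.units_eq_one_or s with rfl | rfl <;> fin_cases k <;> fin_cases i <;> fin_cases j <;>
    simp [mutForm, signedSeed, bichar, formA2, posVec, exchA2, stdVec, Fin.sum_univ_two]

theorem mutExch_smul_exchA2 (s : ℤˣ) (k : Fin 2) :
    mutExch k ((s : ℤ) • exchA2) = ((-s : ℤˣ) : ℤ) • exchA2 := by
  revert s k
  decide

theorem bichar_formA2 (s : ℤ) (f g : Fin 2 → ℤ) :
    bichar ((s : ZMod ℓ) • formA2 ℓ) f g = ((s * (f 0 * g 1 - f 1 * g 0) : ℤ) : ZMod ℓ) := by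
  simp [bichar, formA2, exchA2, Fin.sum_univ_two]
  ring

theorem mutate_zero_signedSeed {q : Aˣ} (hq : q ^ ℓ = 1) {s : ℤˣ} {u v u' : F} (hu : u ≠ 0)
    (h : u * u' = 1 + ((q ^ (s : ℤ) : Aˣ) : A) • v)
    (h' : QuasiComm (q ^ (-(2 * s) : ℤ)) u' v) :
    (signedSeed ℓ q s u v).mutate q 0 = signedSeed ℓ q (-s) u' v := by
  have hnew : newVar 0 (signedSeed ℓ q s u v) = u' := by
    rw [newVar_zero_signedSeed, ← inv_mul_cancel_left₀ hu u', h, mul_add, add_comm]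
    simp [normFrame_apply]
  have hframe : mutFrame q 0 (signedSeed ℓ q s u v) = normFrame (q ^ (-s : ℤ)) u' v := by
    ext f
    have hupdate : Function.update f 0 0 = ![0, f 1] := by
      ext i
      fin_cases i <;> rfl
    rw [mutFrame, hnew, mutForm_signedSeed, bichar_formA2, ← Int.cast_neg, epsPow_intCast hq,
      hupdate, frame_signedSeed, normFrame_apply, zero_mul, neg_zero, zpow_zero, Units.val_one,
      one_smul, zpow_zero, one_mul, h'.symm.zpow_mul_zpow, smul_smul, ← Units.val_mul, normFrame,
      ← zpow_neg, ← zpow_mul, ← zpow_mul, ← zpow_add]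
    congr 3
    simp [stdVec]
    ring
  rw [Seed.mutate, hframe, mutForm_signedSeed, signedSeed, mutExch_smul_exchA2, signedSeed]
  rfl

theorem mutate_one_signedSeed {q : Aˣ} (hq : q ^ ℓ = 1) {s : ℤˣ} {u v v' : F} (hv : v ≠ 0)
    (h : v' * v = 1 + ((q ^ (s : ℤ) : Aˣ) : A) • u) :
    (signedSeed ℓ q s u v).mutate q 1 = signedSeed ℓ q (-s) u v' := by
  have hnew : newVar 1 (signedSeed ℓ q s u v) = v' := by
    rw [newVar_one_signedSeed, ← mul_inv_cancel_right₀ hv v', h, add_mul, add_comm]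
    simp [normFrame_apply]
  have hframe : mutFrame q 1 (signedSeed ℓ q s u v) = normFrame (q ^ (-s : ℤ)) u v' := by
    ext f
    have hupdate : Function.update f 1 0 = ![f 0, 0] := by
      ext i
      fin_cases i <;> rfl
    rw [mutFrame, hnew, mutForm_signedSeed, bichar_formA2, ← Int.cast_neg, epsPow_intCast hq,
      hupdate, frame_signedSeed, normFrame_apply, mul_zero, neg_zero, zpow_zero, Units.val_one,
      one_smul, zpow_zero, mul_one, normFrame, ← zpow_mul]
    congr 3
    simp [stdVec]
  rw [Seed.mutate, hframe, mutForm_signedSeed, signedSeed, mutExch_smul_exchA2, signedSeed]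
  rfl

end Seeds

/-! ## The pentagon of cluster variables -/

section FifthVariable

variable {A E : Type*} [CommRing A] [Ring E] [Algebra A E]

theorem val_zpow_two (q : Aˣ) : ((q ^ (2 : ℤ) : Aˣ) : A) = q * q := by
  rw [zpow_two, Units.val_mul]

theorem val_zpow_neg_two (q : Aˣ) : ((q ^ (-2 : ℤ) : Aˣ) : A) = (q⁻¹ : Aˣ) * (q⁻¹ : Aˣ) := by
  rw [zpow_neg, ← inv_zpow, val_zpow_two]

/-- The fifth cluster variable of type `A₂`, besides `x₁`, `x₂`, `y₁` and `y₂`. -/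
def fifthVar (q : Aˣ) (y1 y2 : E) : E := ((q⁻¹ : Aˣ) : A) • (y1 * y2 - 1)

theorem mul_eq_one_add_smul_fifthVar (q : Aˣ) (y1 y2 : E) :
    y1 * y2 = 1 + (q : A) • fifthVar q y1 y2 := by
  rw [fifthVar, smul_smul, Units.mul_inv, one_smul, add_sub_cancel]

namespace A2Relations

variable {q : Aˣ} {x1 x2 y1 y2 : E}

theorem y2_mul_y1 (h : A2Relations q x1 x2 y1 y2) :
    y2 * y1 = 1 + ((q⁻¹ : Aˣ) : A) • fifthVar q y1 y2 := by
  rw [h.y2y1, val_zpow_neg_two, fifthVar, Algebra.algebraMap_eq_smul_one]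
  module

theorem x2_mul_fifthVar (h : A2Relations q x1 x2 y1 y2) :
    x2 * fifthVar q y1 y2 = 1 + (q : A) • y1 := by
  have hq := q.inv_mul
  have hxyy : x2 * (y1 * y2) = ((q : A) * q) • (y1 + ((q⁻¹ : Aˣ) : A) • (y1 * x1)) := by
    rw [← mul_assoc, h.x2y1, smul_mul_assoc, mul_assoc, h.x2y2, mul_add, mul_one, mul_smul_comm,
      val_zpow_two]
  rw [fifthVar, mul_smul_comm, mul_sub, mul_one, hxyy, h.y1x1]
  match_scalars <;> grind

theorem fifthVar_mul_x2 (h : A2Relations q x1 x2 y1 y2) :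
    fifthVar q y1 y2 * x2 = 1 + ((q⁻¹ : Aˣ) : A) • y1 := by
  have hq := q.inv_mul
  rw [fifthVar, smul_mul_assoc, sub_mul, one_mul, mul_assoc, h.y2x2, mul_add, mul_one,
    mul_smul_comm, h.y1x1]
  match_scalars <;> grind

theorem fifthVar_mul_x1 (h : A2Relations q x1 x2 y1 y2) :
    fifthVar q y1 y2 * x1 = 1 + (q : A) • y2 := by
  have hq := q.inv_mul
  have hyyx : y1 * y2 * x1 = ((q : A) * q) • (y2 + ((q⁻¹ : Aˣ) : A) • (x2 * y2)) := by
    rw [mul_assoc, h.y2x1, mul_smul_comm, ← mul_assoc, h.y1x1, add_mul, one_mul, smul_mul_assoc,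
      val_zpow_two]
  rw [fifthVar, smul_mul_assoc, sub_mul, one_mul, hyyx, h.x2y2]
  match_scalars <;> grind

theorem x1_mul_fifthVar (h : A2Relations q x1 x2 y1 y2) :
    x1 * fifthVar q y1 y2 = 1 + ((q⁻¹ : Aˣ) : A) • y2 := by
  have hq := q.inv_mul
  rw [fifthVar, mul_smul_comm, mul_sub, mul_one, ← mul_assoc, h.x1y1, add_mul, one_mul,
    smul_mul_assoc, h.x2y2]
  match_scalars <;> grind

theorem y1_mul_fifthVar (h : A2Relations q x1 x2 y1 y2) :
    y1 * fifthVar q y1 y2 = ((q ^ (2 : ℤ) : Aˣ) : A) • (fifthVar q y1 y2 * y1) := by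
  have hq := q.inv_mul
  have hyy := h.y2y1
  rw [val_zpow_neg_two, Algebra.algebraMap_eq_smul_one] at hyy
  rw [val_zpow_two, fifthVar, mul_smul_comm, smul_mul_assoc, sub_mul, one_mul, mul_assoc, hyy,
    mul_add, mul_smul_comm, mul_smul_comm, mul_one, mul_sub, mul_one]
  match_scalars <;> grind

theorem fifthVar_mul_y2 (h : A2Relations q x1 x2 y1 y2) :
    fifthVar q y1 y2 * y2 = ((q ^ (2 : ℤ) : Aˣ) : A) • (y2 * fifthVar q y1 y2) := by
  have hq := q.inv_mul
  have hyy := h.y2y1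
  rw [val_zpow_neg_two, Algebra.algebraMap_eq_smul_one] at hyy
  rw [val_zpow_two, fifthVar, mul_smul_comm, smul_mul_assoc, mul_sub, mul_one, ← mul_assoc, hyy,
    add_mul, smul_mul_assoc, smul_mul_assoc, one_mul, sub_mul, one_mul]
  match_scalars <;> grind

end A2Relations

end FifthVariable

section Pentagon

variable {A : Type*} [CommRing A] {F : Type*} [DivisionRing F] [Algebra A F] {ℓ : ℕ} {q : Aˣ}

/-- The five cluster variables of type `A₂` in cyclic order: neighbours quasi-commute, and the
two neighbours of a variable are exchanged for each other by a mutation. -/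
structure Pentagon (q : Aˣ) (z : Fin 5 → F) : Prop where
  ne_zero : ∀ i, z i ≠ 0
  mul_succ : ∀ i, z i * z (i + 1) = ((q ^ (2 : ℤ) : Aˣ) : A) • (z (i + 1) * z i)
  pred_mul_succ : ∀ i, z (i - 1) * z (i + 1) = 1 + (q : A) • z i
  succ_mul_pred : ∀ i, z (i + 1) * z (i - 1) = 1 + ((q⁻¹ : Aˣ) : A) • z i

theorem add_smul_ne_zero {A E ι : Type*} [CommRing A] [Nontrivial A] [AddCommGroup E] [Module A E]
    {b : ι → E} (hb : LinearIndependent A b) {i j : ι} (hij : i ≠ j) (a : A) :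
    b i + a • b j ≠ 0 := fun h =>
  one_ne_zero ((LinearIndepOn.pair_iff b hij).1 (hb.linearIndepOn {i, j}) 1 a
    (by rwa [one_smul])).1

theorem A2Relations.pentagon [Nontrivial A] {x1 x2 y1 y2 : F} (h : A2Relations q x1 x2 y1 y2)
    (hli : LinearIndependent A (pbwMonomial x1 x2 y1 y2)) :
    Pentagon q ![y2, x1, x2, y1, fifthVar q y1 y2] where
  ne_zero := by
    have hx1 : x1 ≠ 0 := by
      simpa [pbwMonomial] using hli.ne_zero ⟨(0, 1, 0, 0), by simp⟩
    have hx2 : x2 ≠ 0 := by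
      simpa [pbwMonomial] using hli.ne_zero ⟨(0, 0, 1, 0), by simp⟩
    have hy1 : y1 ≠ 0 := by
      simpa [pbwMonomial] using hli.ne_zero ⟨(1, 0, 0, 0), by simp⟩
    have hy2 : y2 ≠ 0 := by
      simpa [pbwMonomial] using hli.ne_zero ⟨(0, 0, 0, 1), by simp⟩
    have hy1' : 1 + (q : A) • y1 ≠ 0 := by
      simpa [pbwMonomial] using add_smul_ne_zero hli (i := ⟨(0, 0, 0, 0), by simp⟩)
        (j := ⟨(1, 0, 0, 0), by simp⟩) (by simp) q
    have hw : fifthVar q y1 y2 ≠ 0 := right_ne_zero_of_mul (h.x2_mul_fifthVar.symm ▸ hy1')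
    intro i
    fin_cases i
    exacts [hy2, hx1, hx2, hy1, hw]
  mul_succ := by
    have hx : x1 * x2 = ((q ^ (2 : ℤ) : Aˣ) : A) • (x2 * x1) := by
      rw [mul_eq_smul_comm, ← zpow_neg]
      exact h.x2x1
    intro i
    fin_cases i
    exacts [h.y2x1, hx, h.x2y1, h.y1_mul_fifthVar, h.fifthVar_mul_y2]
  pred_mul_succ := by
    intro i
    fin_cases i
    exacts [h.fifthVar_mul_x1, h.y2x2, h.x1y1, h.x2_mul_fifthVar,
      mul_eq_one_add_smul_fifthVar q y1 y2]
  succ_mul_pred := by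
    intro i
    fin_cases i
    exacts [h.x1_mul_fifthVar, h.x2y2, h.y1x1, h.fifthVar_mul_x2, h.y2_mul_y1]

namespace Pentagon

variable {z : Fin 5 → F}

theorem finFive_add_one_add_one (i : Fin 5) : i + 1 + 1 = i + 2 := add_assoc i 1 1

theorem quasiComm (hz : Pentagon q z) (i : Fin 5) : QuasiComm (q ^ (2 : ℤ)) (z i) (z (i + 1)) :=
  ⟨hz.ne_zero _, hz.ne_zero _, hz.mul_succ i⟩

theorem mul_add_two (hz : Pentagon q z) (i : Fin 5) :
    z i * z (i + 2) = 1 + (q : A) • z (i + 1) := by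
  have h := hz.pred_mul_succ (i + 1)
  rwa [add_sub_cancel_right, finFive_add_one_add_one] at h

theorem add_two_mul (hz : Pentagon q z) (i : Fin 5) :
    z (i + 2) * z i = 1 + ((q⁻¹ : Aˣ) : A) • z (i + 1) := by
  have h := hz.succ_mul_pred (i + 1)
  rwa [add_sub_cancel_right, finFive_add_one_add_one] at h

theorem quasiComm_add_two (hz : Pentagon q z) (i : Fin 5) :
    QuasiComm (q ^ (-2 : ℤ)) (z (i + 2)) (z (i + 1)) := by
  have h := (hz.quasiComm (i + 1)).symm
  rwa [finFive_add_one_add_one, ← zpow_neg] at h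

theorem quasiComm_sub_one (hz : Pentagon q z) (i : Fin 5) :
    QuasiComm (q ^ (2 : ℤ)) (z (i - 1)) (z i) := by
  simpa only [sub_add_cancel] using hz.quasiComm (i - 1)

theorem mem_of_mem (hz : Pentagon q z) {B : Subalgebra A F} {i : Fin 5} (hpred : z (i - 1) ∈ B)
    (hi : z i ∈ B) (hi1 : z (i + 1) ∈ B) (hi2 : z (i + 2) ∈ B) (j : Fin 5) : z j ∈ B := by
  have hindex : ∀ i j : Fin 5, j = i - 1 ∨ j = i ∨ j = i + 1 ∨ j = i + 2 ∨ j = i + 3 := by decide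
  have hsucc : ∀ i : Fin 5, i + 2 + 1 = i + 3 := by decide
  have hpred_eq : ∀ i : Fin 5, i + 2 + 2 = i - 1 := by decide
  have hfifth : z (i + 3) = ((q⁻¹ : Aˣ) : A) • (z (i + 2) * z (i - 1) - 1) := by
    have h := hz.mul_add_two (i + 2)
    rw [hpred_eq, hsucc] at h
    rw [h, add_sub_cancel_left, smul_smul, Units.inv_mul, one_smul]
  rcases hindex i j with rfl | rfl | rfl | rfl | rfl
  · exact hpred
  · exact hi
  · exact hi1
  · exact hi2
  · rw [hfifth]
    exact B.smul_mem (sub_mem (mul_mem hi2 hpred) (one_mem B)) _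

theorem mem_pairTorus (hz : Pentagon q z) (i j : Fin 5) :
    z j ∈ pairTorus A (z i) (z (i + 1)) := by
  obtain ⟨hu, hu', hv, hv'⟩ := pairTorus_le.1 (le_refl (pairTorus A (z i) (z (i + 1))))
  refine hz.mem_of_mem ?_ hu hv ?_ j
  · rw [← mul_inv_cancel_right₀ (hz.ne_zero (i + 1)) (z (i - 1)), hz.pred_mul_succ]
    exact mul_mem (add_mem (one_mem _) (Subalgebra.smul_mem _ hu _)) hv'
  · rw [← inv_mul_cancel_left₀ (hz.ne_zero i) (z (i + 2)), hz.mul_add_two]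
    exact mul_mem hu' (add_mem (one_mem _) (Subalgebra.smul_mem _ hv _))

theorem mutate_zero_pos (hz : Pentagon q z) (hq : q ^ ℓ = 1) (i : Fin 5) :
    (signedSeed ℓ q 1 (z i) (z (i + 1))).mutate q 0 =
      signedSeed ℓ q (-1) (z (i + 2)) (z (i + 1)) :=
  mutate_zero_signedSeed hq (hz.ne_zero _) (by simpa using hz.mul_add_two i)
    (by simpa using hz.quasiComm_add_two i)

theorem mutate_one_pos (hz : Pentagon q z) (hq : q ^ ℓ = 1) (i : Fin 5) :
    (signedSeed ℓ q 1 (z i) (z (i + 1))).mutate q 1 = signedSeed ℓ q (-1) (z i) (z (i - 1)) :=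
  mutate_one_signedSeed hq (hz.ne_zero _) (by simpa using hz.pred_mul_succ i)

theorem mutate_zero_neg (hz : Pentagon q z) (hq : q ^ ℓ = 1) (i : Fin 5) :
    (signedSeed ℓ q (-1) (z (i + 1)) (z i)).mutate q 0 = signedSeed ℓ q 1 (z (i - 1)) (z i) := by
  refine (mutate_zero_signedSeed hq (u' := z (i - 1)) (hz.ne_zero _) ?_ ?_).trans ?_
  · simpa using hz.succ_mul_pred i
  · simpa using hz.quasiComm_sub_one i
  · rw [neg_neg]

theorem mutate_one_neg (hz : Pentagon q z) (hq : q ^ ℓ = 1) (i : Fin 5) :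
    (signedSeed ℓ q (-1) (z (i + 1)) (z i)).mutate q 1 =
      signedSeed ℓ q 1 (z (i + 1)) (z (i + 2)) := by
  refine (mutate_one_signedSeed hq (v' := z (i + 2)) (hz.ne_zero _) ?_).trans ?_
  · simpa using hz.add_two_mul i
  · rw [neg_neg]

theorem exists_eq_of_mutEquiv (hz : Pentagon q z) (hq : q ^ ℓ = 1) {i : Fin 5}
    {t : Seed (Fin 2) ℓ F} (ht : MutEquiv q (signedSeed ℓ q 1 (z i) (z (i + 1))) t) :
    ∃ j, t = signedSeed ℓ q 1 (z j) (z (j + 1)) ∨ t = signedSeed ℓ q (-1) (z (j + 1)) (z j) := by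
  induction ht with
  | refl => exact ⟨i, Or.inl rfl⟩
  | tail _ hmutate ih =>
    obtain ⟨k, rfl⟩ := hmutate
    obtain ⟨j, rfl | rfl⟩ := ih <;> fin_cases k
    · exact ⟨j + 1, Or.inr (by rw [finFive_add_one_add_one]; exact hz.mutate_zero_pos hq j)⟩
    · exact ⟨j - 1, Or.inr (by rw [sub_add_cancel]; exact hz.mutate_one_pos hq j)⟩
    · exact ⟨j - 1, Or.inl (by rw [sub_add_cancel]; exact hz.mutate_zero_neg hq j)⟩
    · exact ⟨j + 1, Or.inl (by rw [finFive_add_one_add_one]; exact hz.mutate_one_neg hq j)⟩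

theorem mem_quantumTorus (hz : Pentagon q z) (hq : q ^ ℓ = 1) {i : Fin 5} {t : Seed (Fin 2) ℓ F}
    (ht : MutEquiv q (signedSeed ℓ q 1 (z i) (z (i + 1))) t) (j : Fin 5) :
    z j ∈ quantumTorus A t.frame := by
  obtain ⟨i, rfl | rfl⟩ := hz.exists_eq_of_mutEquiv hq ht
  · rw [frame_signedSeed, quantumTorus_normFrame]
    exact hz.mem_pairTorus i j
  · rw [frame_signedSeed, quantumTorus_normFrame, pairTorus_comm]
    exact hz.mem_pairTorus i j

theorem exists_stdVec_eq (hz : Pentagon q z) (hq : q ^ ℓ = 1) {i : Fin 5} {t : Seed (Fin 2) ℓ F}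
    (ht : MutEquiv q (signedSeed ℓ q 1 (z i) (z (i + 1))) t) (k : Fin 2) :
    ∃ j, t.frame (stdVec k) = z j := by
  obtain ⟨j, rfl | rfl⟩ := hz.exists_eq_of_mutEquiv hq ht <;> fin_cases k
  · exact ⟨j, normFrame_stdVec_zero _ _ _⟩
  · exact ⟨j + 1, normFrame_stdVec_one _ _ _⟩
  · exact ⟨j + 1, normFrame_stdVec_zero _ _ _⟩
  · exact ⟨j, normFrame_stdVec_one _ _ _⟩

theorem clusterAlgebra_eq (hz : Pentagon q z) (hq : q ^ ℓ = 1) (i : Fin 5) :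
    clusterAlgebra q (signedSeed ℓ q 1 (z i) (z (i + 1))) =
      Algebra.adjoin A {z i, z (i + 1), z (i + 2), z (i - 1)} := by
  apply le_antisymm
  · refine Algebra.adjoin_le ?_
    rintro _ ⟨t, ht, k, rfl⟩
    obtain ⟨j, hj⟩ := hz.exists_stdVec_eq hq ht k
    rw [hj]
    exact hz.mem_of_mem (i := i) (Algebra.subset_adjoin (by simp)) (Algebra.subset_adjoin (by simp))
      (Algebra.subset_adjoin (by simp)) (Algebra.subset_adjoin (by simp)) j
  · refine Algebra.adjoin_le ?_
    rintro _ (rfl | rfl | rfl | rfl) <;> refine Algebra.subset_adjoin ?_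
    · exact ⟨_, Relation.ReflTransGen.refl, 0, (normFrame_stdVec_zero _ _ _).symm⟩
    · exact ⟨_, Relation.ReflTransGen.refl, 1, (normFrame_stdVec_one _ _ _).symm⟩
    · exact ⟨_, Relation.ReflTransGen.single ⟨0, (hz.mutate_zero_pos hq i).symm⟩, 0,
        (normFrame_stdVec_zero _ _ _).symm⟩
    · exact ⟨_, Relation.ReflTransGen.single ⟨1, (hz.mutate_one_pos hq i).symm⟩, 1,
        (normFrame_stdVec_one _ _ _).symm⟩

theorem clusterAlgebra_le_upper (hz : Pentagon q z) (hq : q ^ ℓ = 1) (i : Fin 5) :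
    clusterAlgebra q (signedSeed ℓ q 1 (z i) (z (i + 1))) ≤
      upperClusterAlgebra q (signedSeed ℓ q 1 (z i) (z (i + 1))) := by
  refine le_iInf₂ fun t ht => Algebra.adjoin_le ?_
  rintro _ ⟨s, hs, k, rfl⟩
  obtain ⟨j, hj⟩ := hz.exists_stdVec_eq hq hs k
  rw [hj]
  exact hz.mem_quantumTorus hq ht j

theorem upper_le_pairTorus (hz : Pentagon q z) (hq : q ^ ℓ = 1) (i : Fin 5) :
    upperClusterAlgebra q (signedSeed ℓ q 1 (z i) (z (i + 1))) ≤
      pairTorus A (z i) (z (i + 1)) ⊓ pairTorus A (z (i + 2)) (z (i + 1)) ⊓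
        pairTorus A (z i) (z (i - 1)) := by
  refine le_inf (le_inf ?_ ?_) ?_
  · refine (iInf₂_le _ Relation.ReflTransGen.refl).trans ?_
    rw [frame_signedSeed, quantumTorus_normFrame]
  · refine (iInf₂_le _ (Relation.ReflTransGen.single ⟨0, (hz.mutate_zero_pos hq i).symm⟩)).trans ?_
    rw [frame_signedSeed, quantumTorus_normFrame]
  · refine (iInf₂_le _ (Relation.ReflTransGen.single ⟨1, (hz.mutate_one_pos hq i).symm⟩)).trans ?_
    rw [frame_signedSeed, quantumTorus_normFrame]

end Pentagon

end Pentagon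

/-! ## Toric frames of type `A₂` -/

section ToricFrame

variable {A : Type*} [CommRing A] {F : Type*} [DivisionRing F] [Algebra A F] {ℓ : ℕ} {q : Aˣ}

theorem eq_zpow_of_map_add {g : ℤ → F} (h0 : g 0 = 1) (hadd : ∀ a b, g (a + b) = g a * g b)
    (n : ℤ) : g n = g 1 ^ n := by
  have h1 : g 1 ≠ 0 := by
    refine left_ne_zero_of_mul (b := g (-1)) ?_
    rw [← hadd, add_neg_cancel, h0]
    exact one_ne_zero
  induction n using Int.induction_on with
  | zero => rw [h0, zpow_zero]
  | succ n ih => rw [hadd, ih, zpow_add_one₀ h1]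
  | pred n ih => rw [zpow_sub_one₀ h1, ← ih, eq_mul_inv_iff_mul_eq₀ h1, ← hadd, sub_add_cancel]

namespace IsTwistedBasis

variable {m : ℤ × ℤ → F}

theorem mon_eq_smul (hm : IsTwistedBasis (torusCocycle q) m) (p : ℤ × ℤ) :
    mon (m (1, 0)) (m (0, 1)) p = ((q ^ (p.1 * p.2) : Aˣ) : A) • m p := by
  have hfst : m (p.1, 0) = m (1, 0) ^ p.1 :=
    eq_zpow_of_map_add (g := fun n => m (n, 0)) hm.mk_zero_zero
      (fun a b => by simp [hm.mul_mk_mk]) p.1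
  have hsnd : m (0, p.2) = m (0, 1) ^ p.2 :=
    eq_zpow_of_map_add (g := fun n => m (0, n)) hm.mk_zero_zero
      (fun a b => by simp [hm.mul_mk_mk]) p.2
  rw [mon, ← hfst, ← hsnd, hm.mul_mk_mk, zero_mul, sub_zero, add_zero, zero_add]

theorem quasiComm [Nontrivial A] (hm : IsTwistedBasis (torusCocycle q) m) :
    QuasiComm (q ^ (2 : ℤ)) (m (1, 0)) (m (0, 1)) where
  left_ne_zero := hm.linearIndependent.ne_zero _
  right_ne_zero := hm.linearIndependent.ne_zero _
  mul_eq := by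
    rw [hm.mul_mk_mk, hm.mul_mk_mk, smul_smul, ← Units.val_mul, ← zpow_add]
    norm_num

theorem eq_normFrame (hm : IsTwistedBasis (torusCocycle q) m) (f : Fin 2 → ℤ) :
    m (f 0, f 1) = normFrame q (m (1, 0)) (m (0, 1)) f := by
  have hmon : m (1, 0) ^ f 0 * m (0, 1) ^ f 1 = ((q ^ (f 0 * f 1) : Aˣ) : A) • m (f 0, f 1) :=
    hm.mon_eq_smul (f 0, f 1)
  rw [normFrame, hmon, smul_smul, ← Units.val_mul, ← zpow_add, neg_add_cancel,
    zpow_zero, Units.val_one, one_smul]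

end IsTwistedBasis

namespace IsToricFrame

variable {M : (Fin 2 → ℤ) → F}

theorem isTwistedBasis [Nontrivial A] (hM : IsToricFrame q (formA2 ℓ) M) (hq : q ^ ℓ = 1) :
    IsTwistedBasis (torusCocycle q) (fun p => M ![p.1, p.2]) := by
  have hmul (f g : ℤ × ℤ) : M ![f.1, f.2] * M ![g.1, g.2] =
      (torusCocycle q f g : A) • M ![f.1 + g.1, f.2 + g.2] := by
    have hbichar := bichar_formA2 (ℓ := ℓ) 1 ![f.1, f.2] ![g.1, g.2]
    rw [Int.cast_one, one_smul, one_mul] at hbichar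
    rw [hM.mul, hbichar, epsPow_intCast hq, torusCocycle]
    simp only [Matrix.cons_add_cons, Matrix.empty_add_empty, Matrix.cons_val_zero,
      Matrix.cons_val_one]
  refine ⟨?_, hmul, hM.linearIndependent.comp _ fun p p' h => ?_⟩
  · have h00 := hmul 0 0
    simp only [torusCocycle, Prod.fst_zero, Prod.snd_zero, mul_zero, sub_zero, zpow_zero,
      Units.val_one, one_smul, add_zero] at h00
    exact (mul_eq_left₀ (hM.linearIndependent.ne_zero _)).1 h00
  · exact Prod.ext (congrFun h 0) (congrFun h 1)

theorem seedA2_eq [Nontrivial A] (hM : IsToricFrame q (formA2 ℓ) M) (hq : q ^ ℓ = 1) :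
    seedA2 ℓ M = signedSeed ℓ q 1 (M ![1, 0]) (M ![0, 1]) := by
  have hframe : M = normFrame q (M ![1, 0]) (M ![0, 1]) := by
    ext f
    rw [← (hM.isTwistedBasis hq).eq_normFrame f]
    congr 1
    ext i
    fin_cases i <;> rfl
  rw [seedA2, signedSeed, Units.val_one, zpow_one, Int.cast_one, one_smul, one_smul, ← hframe]

end IsToricFrame

end ToricFrame

/-! ## Intersections of tori -/

section Intersection

theorem eventually_mem_of_mem_spanOn {A E E' G ι : Type*} [Semiring A] [AddCommMonoid E]
    [Module A E] [AddCommMonoid E'] [Module A E'] {l : Filter ι} {T : ι → E →ₗ[A] E'}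
    {P : ι → Submodule A E'} {m : G → E} {S : Set G}
    (h : ∀ f ∈ S, ∀ᶠ n in l, T n (m f) ∈ P n) {x : E} (hx : x ∈ spanOn A m S) :
    ∀ᶠ n in l, T n x ∈ P n := by
  induction hx using Submodule.span_induction with
  | mem x hx =>
    obtain ⟨f, hf, rfl⟩ := hx
    exact h f hf
  | zero => exact .of_forall fun n => by rw [map_zero]; exact zero_mem _
  | add x y _ _ hx hy =>
    filter_upwards [hx, hy] with n hxn hyn
    rw [map_add]
    exact add_mem hxn hyn
  | smul r x _ hx =>
    filter_upwards [hx] with n hxn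
    rw [map_smul]
    exact (P n).smul_mem r hxn

variable {A : Type*} [CommRing A] {F : Type*} [DivisionRing F] [Algebra A F]

namespace QuasiComm

variable {s t : Aˣ} {u v u' : F}

theorem eventually_pow_mul_mem (h : QuasiComm s u v) {B : Subalgebra A F} (hu : u ∈ B)
    (hv : v ∈ B) {x : F} (hx : x ∈ spanOn A (mon u v) {f | 0 ≤ f.1}) :
    ∀ᶠ N : ℕ in Filter.atTop, v ^ N * x ∈ B := by
  refine eventually_mem_of_mem_spanOn (T := fun N => LinearMap.mulLeft A (v ^ N))
    (P := fun _ => Subalgebra.toSubmodule B) (fun f hf => ?_) hx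
  filter_upwards [Filter.eventually_ge_atTop (-f.2).toNat] with N hN
  obtain ⟨i, hi⟩ := Int.eq_ofNat_of_zero_le (show 0 ≤ f.1 from hf)
  obtain ⟨j, hj⟩ := Int.eq_ofNat_of_zero_le (show 0 ≤ N + f.2 by lia)
  have hmon : v ^ N * mon u v f = ((s ^ (-(f.1 * N)) : Aˣ) : A) • (u ^ i * v ^ j) := by
    simpa [mon, hi, hj] using h.mon_mul (0, N) f
  rw [LinearMap.mulLeft_apply, hmon]
  exact B.smul_mem (mul_mem (pow_mem hu i) (pow_mem hv j)) _

theorem pow_mul_zpow_mem (h : QuasiComm s u v) (hli : LinearIndependent A (mon u v))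
    (hu' : u' ∈ spanOn A (mon u v) {f | f.1 = -1}) (n : ℕ) (j : ℤ) :
    u' ^ n * v ^ j ∈ spanOn A (mon u v) {f | f.1 = -n} := by
  induction n with
  | zero => exact Submodule.subset_span ⟨(0, j), by simp, by simp [mon]⟩
  | succ n ih =>
    rw [pow_succ', mul_assoc]
    refine (h.isTwistedBasis hli).mul_mem (fun f hf g hg => ?_) hu' ih
    simp only [Set.mem_ofPred_eq, Prod.fst_add] at hf hg ⊢
    lia

/-- Multiplication by a high power of `u'` moves `x` into the span of the monomials `u'^i v^j`
with `i ≥ 0`, and a leading form in the degree of `u` cannot be cancelled by this. -/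
theorem mem_spanOn_nonneg (h : QuasiComm s u v) (hli : LinearIndependent A (mon u v))
    (hu' : u' ∈ spanOn A (mon u v) {f | f.1 = -1}) (hu'0 : u' ≠ 0) {x : F}
    (hx : x ∈ spanOn A (mon u v) Set.univ) (hx' : x ∈ spanOn A (mon u' v) {f | f.1 ≤ 0}) :
    x ∈ spanOn A (mon u v) {f | 0 ≤ f.1} := by
  let d : ℤ × ℤ →+ ℤ := -AddMonoidHom.fst ℤ ℤ
  have hbound : ∀ᶠ N : ℕ in Filter.atTop, u' ^ N * x ∈ spanOn A (mon u v) {f | d f ≤ N} := by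
    refine eventually_mem_of_mem_spanOn (T := fun N : ℕ => LinearMap.mulLeft A (u' ^ N))
      (P := fun N : ℕ => spanOn A (mon u v) {f | d f ≤ N}) (fun f hf => ?_) hx'
    filter_upwards [Filter.eventually_ge_atTop (-f.1).toNat] with N hN
    obtain ⟨i, hi⟩ := Int.eq_ofNat_of_zero_le (show 0 ≤ N + f.1 by lia)
    have hmul : u' ^ N * mon u' v f = u' ^ i * v ^ f.2 := by
      rw [mon, ← mul_assoc, ← zpow_natCast, ← zpow_add₀ hu'0, hi, zpow_natCast]
    rw [LinearMap.mulLeft_apply, hmul]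
    refine spanOn_mono (fun g hg => ?_) (h.pow_mul_zpow_mem hli hu' i f.2)
    simp only [Set.mem_ofPred_eq, d, AddMonoidHom.neg_apply, AddMonoidHom.coe_fst] at hf hg ⊢
    lia
  obtain ⟨N, hN⟩ := hbound.exists
  obtain ⟨k, hk⟩ := exists_hasLeadingForm_of_mem_le hN
  have hpow : HasLeadingForm A (mon u v) d N (u' ^ N) (u' ^ N) := by
    refine HasLeadingForm.of_mem (spanOn_mono (fun f hf => ?_)
      (by simpa using h.pow_mul_zpow_mem hli hu' N 0))
    simp only [Set.mem_ofPred_eq, d, AddMonoidHom.neg_apply, AddMonoidHom.coe_fst] at hf ⊢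
    lia
  obtain ⟨g, hg, -⟩ := hpow.of_mul (h.isTwistedBasis hli) (pow_ne_zero N hu'0) hx
    (by rwa [add_zero])
  refine spanOn_mono (fun f hf => ?_) hg.mem_le
  simpa [d] using hf

theorem eventually_pow_mul_mem_of_mem_pairTorus (h : QuasiComm s u v) (h' : QuasiComm t u' v)
    (hli : LinearIndependent A (mon u v)) (hu' : u' ∈ spanOn A (mon u v) {f | f.1 = -1})
    {B : Subalgebra A F} (huB : u ∈ B) (huB' : u' ∈ B) (hvB : v ∈ B) {x : F}
    (hx : x ∈ pairTorus A u v) (hx' : x ∈ pairTorus A u' v) :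
    ∀ᶠ N : ℕ in Filter.atTop, v ^ N * x ∈ B := by
  rw [← Subalgebra.mem_toSubmodule, ← h.spanOn_mon] at hx
  rw [← Subalgebra.mem_toSubmodule, ← h'.spanOn_mon] at hx'
  obtain ⟨y, hy, z, hz, rfl⟩ := mem_spanOn_union.1 (spanOn_mono
    (S' := {f : ℤ × ℤ | 0 ≤ f.1} ∪ {f | f.1 ≤ 0}) (fun f _ => le_total 0 f.1) hx')
  have hyu : y ∈ spanOn A (mon u v) Set.univ := by
    refine spanOn_le.2 (fun f hf => ?_) hy
    obtain ⟨i, hi⟩ := Int.eq_ofNat_of_zero_le (show 0 ≤ f.1 from hf)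
    rw [mon, hi, zpow_natCast]
    exact spanOn_mono (Set.subset_univ _) (h.pow_mul_zpow_mem hli hu' i f.2)
  have hz' : z ∈ spanOn A (mon u v) {f | 0 ≤ f.1} :=
    h.mem_spanOn_nonneg hli hu' h'.left_ne_zero
      ((Submodule.add_mem_iff_right _ hyu).1 hx) hz
  filter_upwards [h'.eventually_pow_mul_mem huB' hvB hy, h.eventually_pow_mul_mem huB hvB hz']
    with N hyN hzN
  rw [mul_add]
  exact add_mem hyN hzN

theorem exists_eq_mul_of_pow_mul_eq_mul {r : A} (hr : u * u' = 1 + r • v) {B : Subalgebra A F}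
    (hu' : u' ∈ B) (hv : v ∈ B) (n : ℕ) {g k : F} (hg : g ∈ B) (hk : k ∈ B)
    (hgk : v ^ n * g = u * k) : ∃ g' ∈ B, g = u * g' := by
  induction n generalizing g with
  | zero => exact ⟨k, hk, by rwa [pow_zero, one_mul] at hgk⟩
  | succ n ih =>
    obtain ⟨k', hk', hvg⟩ := ih (mul_mem hv hg) (by rwa [← mul_assoc, ← pow_succ])
    refine ⟨u' * g - r • k', sub_mem (mul_mem hu' hg) (B.smul_mem hk' _), ?_⟩
    rw [mul_sub, ← mul_assoc, hr, mul_smul_comm, ← hvg, add_mul, one_mul, smul_mul_assoc,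
      add_sub_cancel_right]

theorem mem_of_pow_mul_mem (h : QuasiComm s u v) {r : A} (hr : u * u' = 1 + r • v)
    {B : Subalgebra A F} (hu : u ∈ B) (hu' : u' ∈ B) (hv : v ∈ B) {x : F} {a b : ℕ}
    (ha : u ^ a * x ∈ B) (hb : v ^ b * x ∈ B) : x ∈ B := by
  induction a with
  | zero => rwa [pow_zero, one_mul] at ha
  | succ a ih =>
    obtain ⟨e, he⟩ : ∃ e : A, v ^ b * u ^ (a + 1) = e • (u ^ (a + 1) * v ^ b) :=
      ⟨_, by simpa only [zpow_natCast] using h.symm.zpow_mul_zpow b (a + 1 : ℕ)⟩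
    have hcomm : v ^ b * (u ^ (a + 1) * x) = u * e • (u ^ a * (v ^ b * x)) := by
      rw [← mul_assoc, he, smul_mul_assoc, mul_smul_comm, pow_succ']
      simp only [mul_assoc]
    obtain ⟨g, hg, hug⟩ := exists_eq_mul_of_pow_mul_eq_mul hr hu' hv b ha
      (B.smul_mem (mul_mem (pow_mem hu a) hb) e) hcomm
    rw [pow_succ', mul_assoc] at hug
    exact ih (mul_left_cancel₀ h.left_ne_zero hug ▸ hg)

end QuasiComm

theorem A2Relations.mem_adjoin_of_mem_pairTorus {q : Aˣ} {x1 x2 y1 y2 : F}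
    (h : A2Relations q x1 x2 y1 y2) {s s' t : Aˣ} (hx : QuasiComm t x1 x2)
    (hy1 : QuasiComm s y1 x2) (hy2 : QuasiComm s' y2 x1) (hli : LinearIndependent A (mon x1 x2))
    (hli' : LinearIndependent A (mon x2 x1)) {x : F} (hx12 : x ∈ pairTorus A x1 x2)
    (hxy1 : x ∈ pairTorus A y1 x2) (hxy2 : x ∈ pairTorus A x1 y2) :
    x ∈ Algebra.adjoin A {x1, x2, y1, y2} := by
  have hx1B : x1 ∈ Algebra.adjoin A {x1, x2, y1, y2} := Algebra.subset_adjoin (by simp)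
  have hx2B : x2 ∈ Algebra.adjoin A {x1, x2, y1, y2} := Algebra.subset_adjoin (by simp)
  have hy1B : y1 ∈ Algebra.adjoin A {x1, x2, y1, y2} := Algebra.subset_adjoin (by simp)
  have hy2B : y2 ∈ Algebra.adjoin A {x1, x2, y1, y2} := Algebra.subset_adjoin (by simp)
  have hdegree {u v u' : F} {r : A} (hu : u ≠ 0) (hu' : u * u' = 1 + r • v) :
      u' ∈ spanOn A (mon u v) {f | f.1 = -1} := by
    have hsum : u' = mon u v (-1, 0) + r • mon u v (-1, 1) := by
      rw [← inv_mul_cancel_left₀ hu u', hu']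
      simp [mon, mul_add]
    rw [hsum]
    exact Submodule.add_mem _ (mem_spanOn _ rfl) (Submodule.smul_mem _ _ (mem_spanOn _ rfl))
  obtain ⟨N, hN⟩ := (hx.eventually_pow_mul_mem_of_mem_pairTorus hy1 hli
    (hdegree hx.left_ne_zero h.x1y1) hx1B hy1B hx2B hx12 hxy1).exists
  obtain ⟨N', hN'⟩ := (hx.symm.eventually_pow_mul_mem_of_mem_pairTorus hy2 hli'
    (hdegree hx.right_ne_zero h.x2y2) hx2B hy2B hx1B (by rwa [pairTorus_comm])
    (by rwa [pairTorus_comm])).exists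
  exact hx.mem_of_pow_mul_mem h.x1y1 hx1B hy1B hx2B hN' hN

end Intersection

/-! ## Conductors of twisted group algebras -/

section Conductor

variable {A E G Γ : Type*} [CommRing A] [Ring E] [NoZeroDivisors E] [Algebra A E]
variable [AddCommGroup Γ] [LinearOrder Γ] [IsOrderedAddMonoid Γ]

theorem HasLeadingForm.exists_mul_pow [AddMonoid G] {c : G → G → Aˣ} {m : G → E} {d : G →+ Γ}
    (hm : IsTwistedBasis c m) {γ δ : Γ} {g h e x : E} (he : HasLeadingForm A m d γ g e)
    (hg : g ≠ 0) (hex : HasLeadingForm A m d (γ + δ) h (e * x)) (hcomm : Commute e x)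
    (hmem : ∀ n, e * x ^ n ∈ spanOn A m Set.univ) (n : ℕ) :
    ∃ k, HasLeadingForm A m d (γ + n • δ) k (e * x ^ n) ∧ g ^ n * k = g * h ^ n := by
  induction n with
  | zero => exact ⟨g, by simpa only [zero_smul, add_zero, pow_zero, mul_one] using he, by simp⟩
  | succ n ih =>
    obtain ⟨k, hk, hgk⟩ := ih
    have hcomm' : e * x ^ n * (e * x) = e * (e * x ^ (n + 1)) := by
      rw [pow_succ, mul_assoc e, ← mul_assoc (x ^ n), ← (hcomm.pow_right n).eq, mul_assoc e]
    have hmul := hk.mul hm hex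
    rw [hcomm', show γ + n • δ + (γ + δ) = γ + (γ + (n + 1) • δ) by
      rw [succ_nsmul]; abel] at hmul
    obtain ⟨k', hk', hgk'⟩ := he.of_mul hm hg (hmem (n + 1)) hmul
    exact ⟨k', hk', by rw [pow_succ, mul_assoc, hgk', ← mul_assoc, hgk, mul_assoc, pow_succ]⟩

variable [AddCommGroup G] {c : G → G → Aˣ} {m : G → E} {d : G →+ Γ}

/-- The leading index `f + n • g` of `e * x ^ n` has degree at most linear in `n`. -/
theorem IsTwistedBasis.degree_le_of_mul_pow_mem (hm : IsTwistedBasis c m)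
    (hd : Function.Injective d) {f g : G} {h k e x : E} (he : HasLeadingForm A m d (d f) h e)
    (hh : h ≠ 0) (hex : HasLeadingForm A m d (d f + d g) k (e * x)) (hk : k ≠ 0)
    (hcomm : Commute e x) (hmem : ∀ n, e * x ^ n ∈ spanOn A m Set.univ)
    {d' : G →+ ℤ} {γ δ : ℤ} {h' k' : E} (he' : HasLeadingForm A m d' γ h' e) (hh' : h' ≠ 0)
    (hex' : HasLeadingForm A m d' (γ + δ) k' (e * x)) : d' g ≤ δ := by
  have hle (n : ℕ) : d' f + n * d' g ≤ γ + n * δ := by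
    obtain ⟨r, hr, hhr⟩ := he.exists_mul_pow hm hh hex hcomm hmem n
    obtain ⟨s, hs, -⟩ := he'.exists_mul_pow hm hh' hex' hcomm hmem n
    have hr0 : r ≠ 0 := by
      rintro rfl
      exact mul_ne_zero hh (pow_ne_zero n hk) (by rw [← hhr, mul_zero])
    obtain ⟨f', hf', hdf'⟩ := hr.exists_mem_eq hm.linearIndependent hr0 hs.mem_le
    obtain rfl : f' = f + n • g := hd (by rw [hdf', map_add, map_nsmul])
    simpa only [Set.mem_ofPred_eq, map_add, map_nsmul, nsmul_eq_mul] using hf'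
  by_contra! hlt
  have hn := hle (γ - d' f + 1).toNat
  have htoNat := Int.self_le_toNat (γ - d' f + 1)
  nlinarith

theorem IsTwistedBasis.dvd_of_mul_pow_mem (hm : IsTwistedBasis c m)
    (hA : ∀ a b r : A, a ≠ 0 → r ≠ 0 → (∀ n, a ^ n ∣ r * b ^ n) → a ∣ b)
    (hd : Function.Injective d) {f g : G} {a b : A} {e x : E} (ha : a ≠ 0)
    (he : HasLeadingForm A m d (d f) (a • m f) e)
    (hex : HasLeadingForm A m d (d f + d g) (b • m (f + g)) (e * x))
    (hcomm : Commute e x) (hmem : ∀ n, e * x ^ n ∈ spanOn A m Set.univ) : a ∣ b := by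
  have ham : a • m f ≠ 0 := fun h0 =>
    ha (hm.linearIndependent.smul_left_injective f (h0.trans (zero_smul A _).symm))
  refine hA a b a ha ha fun n => ?_
  obtain ⟨k, hk, hak⟩ := he.exists_mul_pow hm ham hex hcomm hmem n
  obtain ⟨r, rfl⟩ : ∃ r : A, r • m (f + n • g) = k :=
    mem_spanOn_singleton.1 (spanOn_mono (fun f' hf' => hd (by
      rw [map_add, map_nsmul]
      exact hf')) hk.mem)
  obtain ⟨u, hu⟩ := hm.exists_pow_eq f n
  obtain ⟨v, hv⟩ := hm.exists_pow_eq (f + g) n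
  simp only [smul_pow, hu, hv, smul_mul_smul_comm, smul_smul, hm.mul] at hak
  rw [show n • f + (f + n • g) = f + n • (f + g) by rw [nsmul_add]; abel] at hak
  have hcoeff := hm.linearIndependent.smul_left_injective _ hak
  refine (Units.dvd_mul_right (u := v * c f (n • (f + g)))).1 ⟨u * r * c (n • f) (f + n • g), ?_⟩
  rw [Units.val_mul, ← mul_assoc, mul_assoc a, ← hcoeff]
  ring

theorem IsTwistedBasis.exists_reduction {ι : Type*} (hm : IsTwistedBasis c m)
    (hA : ∀ a b r : A, a ≠ 0 → r ≠ 0 → (∀ n, a ^ n ∣ r * b ^ n) → a ∣ b)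
    (hd : Function.Injective d) {d' : ι → G →+ ℤ} {f : G} {a : A} {e x : E} (ha : a ≠ 0)
    (he : HasLeadingForm A m d (d f) (a • m f) e) {γ δ : ι → ℤ} {h' : ι → E}
    (he' : ∀ i, HasLeadingForm A m (d' i) (γ i) (h' i) e) (hh' : ∀ i, h' i ≠ 0)
    (hcomm : Commute e x) (hmem : ∀ n, e * x ^ n ∈ spanOn A m Set.univ)
    (hbound : ∀ i, e * x ∈ spanOn A m {g | d' i g ≤ γ i + δ i}) (hex0 : e * x ≠ 0) :
    ∃ g, (∀ i, d' i g ≤ δ i) ∧ (∃ k ≠ 0, HasLeadingForm A m d (d f + d g) k (e * x)) ∧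
      ∃ r : A, e * (x - r • m g) ∈ spanOn A m {g' | d g' < d f + d g} ∧
        ∀ i, e * (x - r • m g) ∈ spanOn A m {g | d' i g ≤ γ i + δ i} := by
  have ham : a • m f ≠ 0 := fun h0 =>
    ha (hm.linearIndependent.smul_left_injective f (h0.trans (zero_smul A _).symm))
  obtain ⟨_, k, hk, hex⟩ := exists_hasLeadingForm hm.linearIndependent d
    (by simpa only [pow_one] using hmem 1) hex0
  obtain ⟨f', rfl, b, rfl⟩ := hex.exists_smul_eq hd hk
  obtain ⟨g, rfl⟩ : ∃ g, f' = f + g := ⟨f' - f, by abel⟩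
  rw [map_add] at hex
  have hg (i : ι) : d' i g ≤ δ i := by
    obtain ⟨h, hh⟩ := exists_hasLeadingForm_of_mem_le (hbound i)
    exact hm.degree_le_of_mul_pow_mem hd he ham hex hk hcomm hmem (he' i) (hh' i) hh
  obtain ⟨r, hr⟩ := he.exists_mul_sub_smul_mem_lt hm
    (hm.dvd_of_mul_pow_mem hA hd ha he hex hcomm hmem) hex
  refine ⟨g, hg, ⟨_, hk, hex⟩, r, hr, fun i => ?_⟩
  rw [mul_sub]
  refine Submodule.sub_mem _ (hbound i)
    (hm.mul_mem ?_ (he' i).mem_le (Submodule.smul_mem _ r (mem_spanOn m (Set.mem_singleton g))))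
  rintro f' hf' _ rfl
  rw [Set.mem_ofPred_eq, map_add]
  exact add_le_add hf' (hg i)

/-- Among the elements of `R` outside the span, one of least leading index is reduced further. -/
theorem IsTwistedBasis.mem_of_mul_mem_of_degree_le {ι : Type*} (hm : IsTwistedBasis c m)
    (hA : ∀ a b r : A, a ≠ 0 → r ≠ 0 → (∀ n, a ^ n ∣ r * b ^ n) → a ∣ b)
    (hd : Function.Injective d) {d' : ι → G →+ ℤ}
    {R : Subring E} (hR : ∀ y ∈ spanOn A m Set.univ, y ∈ R) {e : E}
    (hcomm : ∀ x ∈ R, Commute e x) (heR : ∀ x ∈ R, e * x ∈ spanOn A m Set.univ)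
    {f : G} {a : A} (ha : a ≠ 0) (hlead : HasLeadingForm A m d (d f) (a • m f) e)
    {γ δ : ι → ℤ} {h' : ι → E} (hlead' : ∀ i, HasLeadingForm A m (d' i) (γ i) (h' i) e)
    (hh' : ∀ i, h' i ≠ 0) (hfin : {g | ∀ i, d' i g ≤ δ i}.Finite) (he0 : e ≠ 0) {x : E}
    (hx : x ∈ R) (hδ : ∀ i, e * x ∈ spanOn A m {g | d' i g ≤ γ i + δ i}) :
    x ∈ spanOn A m Set.univ := by
  by_contra hxT
  have reduce {y : E} (hyT : y ∉ spanOn A m Set.univ) (hy : y ∈ R)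
      (hbound : ∀ i, e * y ∈ spanOn A m {g | d' i g ≤ γ i + δ i}) :=
    hm.exists_reduction hA hd ha hlead hlead' hh' (hcomm y hy) (fun n => heR _ (pow_mem hy n))
      hbound (mul_ne_zero he0 fun h0 => hyT (h0 ▸ Submodule.zero_mem _))
  let bad : Set G := {g | (∀ i, d' i g ≤ δ i) ∧ ∃ y ∉ spanOn A m Set.univ, y ∈ R ∧
    (∀ i, e * y ∈ spanOn A m {g | d' i g ≤ γ i + δ i}) ∧
    e * y ∈ spanOn A m {g' | d g' ≤ d f + d g}}
  obtain ⟨g₀, hg₀, ⟨_, -, hk₀⟩, -⟩ := reduce hxT hx hδ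
  obtain ⟨g, ⟨-, y, hyT, hy, hbound, hle⟩, hmin⟩ := Set.exists_min_image bad d
    (hfin.subset fun _ h => h.1) ⟨g₀, hg₀, x, hxT, hx, hδ, hk₀.mem_le⟩
  obtain ⟨g₁, -, ⟨k₁, hk₁, hlead₁⟩, r, hlt, hbound'⟩ := reduce hyT hy hbound
  have hr : r • m g₁ ∈ spanOn A m Set.univ :=
    Submodule.smul_mem _ r (mem_spanOn m (Set.mem_univ g₁))
  have hyT' : y - r • m g₁ ∉ spanOn A m Set.univ := fun h =>
    hyT (by simpa only [sub_add_cancel] using Submodule.add_mem _ h hr)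
  have hy' : y - r • m g₁ ∈ R := Subring.sub_mem _ hy (hR _ hr)
  obtain ⟨g₂, hg₂, ⟨k₂, hk₂, hlead₂⟩, -⟩ := reduce hyT' hy' hbound'
  obtain ⟨f₁, hf₁, hf₁'⟩ := hlead₁.exists_mem_eq hm.linearIndependent hk₁ hle
  obtain ⟨f₂, hf₂, hf₂'⟩ := hlead₂.exists_mem_eq hm.linearIndependent hk₂ hlt
  have h₁ : d g₁ ≤ d g := le_of_add_le_add_left (hf₁'.symm.trans_le hf₁)
  have h₂ : d g₂ < d g₁ := lt_of_add_lt_add_left (hf₂'.symm.trans_lt hf₂)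
  exact (hmin g₂ ⟨hg₂, y - r • m g₁, hyT', hy', hbound', hlead₂.mem_le⟩).not_gt (h₂.trans_le h₁)

theorem IsTwistedBasis.mem_of_mul_mem {ι : Type*} (hm : IsTwistedBasis c m)
    (hA : ∀ a b r : A, a ≠ 0 → r ≠ 0 → (∀ n, a ^ n ∣ r * b ^ n) → a ∣ b)
    (hd : Function.Injective d) {d' : ι → G →+ ℤ}
    (hfin : ∀ δ : ι → ℤ, {g | ∀ i, d' i g ≤ δ i}.Finite)
    {R : Subring E} (hR : ∀ y ∈ spanOn A m Set.univ, y ∈ R) {e : E}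
    (he : e ∈ spanOn A m Set.univ) (he0 : e ≠ 0) (hcomm : ∀ x ∈ R, Commute e x)
    (heR : ∀ x ∈ R, e * x ∈ spanOn A m Set.univ) {x : E} (hx : x ∈ R) :
    x ∈ spanOn A m Set.univ := by
  obtain ⟨_, _, hh, hlead⟩ := exists_hasLeadingForm hm.linearIndependent d he he0
  obtain ⟨f, rfl, a, rfl⟩ := hlead.exists_smul_eq hd hh
  have ha : a ≠ 0 := fun h0 => hh (by rw [h0, zero_smul])
  choose γ h' hh' hlead' using fun i => exists_hasLeadingForm hm.linearIndependent (d' i) he he0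
  rcases eq_or_ne x 0 with rfl | hx0
  · exact Submodule.zero_mem _
  choose δ _ _ hδ using fun i =>
    exists_hasLeadingForm hm.linearIndependent (d' i) (heR x hx) (mul_ne_zero he0 hx0)
  exact hm.mem_of_mul_mem_of_degree_le hA hd hR hcomm heR ha hlead hlead' hh'
    (hfin fun i => δ i - γ i) he0 hx
    fun i => by simpa only [add_sub_cancel] using (hδ i).mem_le

end Conductor

/-! ## Central fractions and maximal orders -/

section CentralFractions

variable {F : Type*} [DivisionRing F]

/-- Every element of the division ring `F` is a fraction of elements of the subring `B` whose
denominator is central in `F`. -/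
def HasCentralFractions (B : Subring F) : Prop :=
  ∀ x : F, ∃ z ∈ B, z ≠ 0 ∧ z ∈ Subring.center F ∧ z * x ∈ B

theorem commute_of_mem_center {R : Type*} [Ring R] {z : R} (hz : z ∈ Subring.center R) (x : R) :
    Commute z x :=
  (Subring.mem_center_iff.1 hz x).symm

namespace HasCentralFractions

variable {B : Subring F}

theorem isOrderIn (hB : HasCentralFractions B) : IsOrderIn B := by
  intro x
  obtain ⟨z, hz, hz0, hzc, hzx⟩ := hB x
  refine ⟨⟨z * x, hzx, Units.mk0 z hz0, hz, ?_⟩, Units.mk0 z hz0, hz, z * x, hzx, ?_⟩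
  · rw [(commute_of_mem_center hzc x).eq, Units.val_inv_eq_inv_val, Units.val_mk0,
      mul_inv_cancel_right₀ hz0]
  · rw [Units.val_inv_eq_inv_val, Units.val_mk0, inv_mul_cancel_left₀ hz0]

theorem mem_center_of_commute (hB : HasCentralFractions B) {w : F} (hw : ∀ b ∈ B, Commute w b) :
    w ∈ Subring.center F := by
  refine Subring.mem_center_iff.2 fun x => ?_
  obtain ⟨z, -, hz0, hzc, hzx⟩ := hB x
  refine mul_left_cancel₀ hz0 ?_
  rw [← mul_assoc, ← (hw _ hzx).eq, ← mul_assoc, ← (commute_of_mem_center hzc w).eq, mul_assoc]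

theorem exists_conductor (hB : HasCentralFractions B) {R : Subring F}
    (hR : OrdersEquivalent B R) :
    ∃ e ∈ Subring.center F, e ≠ 0 ∧ ∀ y ∈ R, e * y ∈ B := by
  obtain ⟨-, -, a, b, -, hab⟩ := hR
  obtain ⟨z, -, hz0, hzc, hza⟩ := hB ((a⁻¹ : Fˣ) : F)
  obtain ⟨z', -, hz0', hzc', hzb⟩ := hB ((b⁻¹ : Fˣ) : F)
  refine ⟨z * z', mul_mem hzc hzc', mul_ne_zero hz0 hz0', fun y hy => ?_⟩
  have hfactor : z * z' * y = z * ((a⁻¹ : Fˣ) : F) * (a * y * b) * (z' * ((b⁻¹ : Fˣ) : F)) := by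
    rw [(commute_of_mem_center hzc' _).eq]
    simp only [mul_assoc, Units.inv_mul_cancel_left, Units.mul_inv_cancel_left]
    rw [(commute_of_mem_center hzc' y).eq]
  rw [hfactor]
  exact mul_mem (mul_mem hza (hab y hy)) hzb

theorem isMaximalOrderIn (hB : HasCentralFractions B)
    (h : ∀ R : Subring F, B ≤ R → ∀ e ∈ Subring.center F, e ≠ 0 → (∀ y ∈ R, e * y ∈ B) → R ≤ B) :
    IsMaximalOrderIn B := by
  refine ⟨hB.isOrderIn, fun R _ heq hle => ?_⟩
  obtain ⟨e, hec, he0, he⟩ := hB.exists_conductor heq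
  exact le_antisymm (h R hle e hec he0 he) hle

theorem of_pow_mul_mem {T : Subring F} (hT : HasCentralFractions T) {w : F}
    (hw0 : w ≠ 0) (hwc : w ∈ Subring.center F)
    (hTB : ∀ t ∈ T, ∀ᶠ N in Filter.atTop, w ^ N * t ∈ B) : HasCentralFractions B := by
  intro x
  obtain ⟨z, hz, hz0, hzc, hzx⟩ := hT x
  obtain ⟨N, hN, hN'⟩ := ((hTB z hz).and (hTB _ hzx)).exists
  exact ⟨w ^ N * z, hN, mul_ne_zero (pow_ne_zero N hw0) hz0, mul_mem (pow_mem hwc N) hzc,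
    by rwa [mul_assoc]⟩

end HasCentralFractions

/-- The subring `R[w⁻¹]` of a division ring, for a central element `w` of `R`. -/
def adjoinInv (R : Subring F) (w : F) (hw : w ∈ R) (hwc : w ∈ Subring.center F) : Subring F where
  carrier := {y | ∀ᶠ N in Filter.atTop, w ^ N * y ∈ R}
  mul_mem' {y z} hy hz := by
    obtain ⟨N₀, hN₀⟩ := Filter.eventually_atTop.1 hy
    obtain ⟨N₁, hN₁⟩ := Filter.eventually_atTop.1 hz
    filter_upwards [Filter.eventually_ge_atTop (N₀ + N₁)] with N hN
    obtain ⟨k, rfl⟩ := Nat.exists_eq_add_of_le (le_of_add_le_left hN)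
    have hsplit : w ^ (N₀ + k) * (y * z) = w ^ N₀ * y * (w ^ k * z) := by
      rw [pow_add, mul_assoc, mul_assoc, ← mul_assoc (w ^ k),
        (commute_of_mem_center (pow_mem hwc k) y).eq, mul_assoc]
    rw [hsplit]
    exact mul_mem (hN₀ _ le_rfl) (hN₁ k (by lia))
  one_mem' := .of_forall fun N => by rw [mul_one]; exact pow_mem hw N
  add_mem' hy hz := by
    filter_upwards [hy, hz] with N hyN hzN
    rw [mul_add]
    exact add_mem hyN hzN
  zero_mem' := .of_forall fun N => by rw [mul_zero]; exact zero_mem R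
  neg_mem' hy := by
    filter_upwards [hy] with N hyN
    rw [mul_neg]
    exact neg_mem hyN

end CentralFractions

/-! ## Division rings of fractions -/

section Fractions

open scoped nonZeroDivisors

variable {D : Type*} [Ring D]

theorem exists_mul_mem_center [NoZeroDivisors D]
    [Algebra.IsAlgebraic (Subring.center D) D] {b : D} (hb : b ≠ 0) :
    ∃ b' : D, b' * b ≠ 0 ∧ b' * b ∈ Subring.center D := by
  obtain ⟨z, hz, b', hzb⟩ := (Algebra.IsAlgebraic.isAlgebraic (R := Subring.center D)
    b).exists_nonzero_dvd (mem_nonZeroDivisors_of_ne_zero hb)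
  have hcomm : b' * b = z := by
    refine mul_left_cancel₀ hb ?_
    rw [← mul_assoc, ← hzb]
    exact (commute_of_mem_center z.2 b).eq
  exact ⟨b', fun h => hz (Subtype.ext (hcomm.symm.trans h)), hcomm ▸ z.2⟩

variable {F : Type*} [DivisionRing F] {φ : D →+* F}

theorem map_mem_center (hfrac : ∀ x : F, ∃ s r : D, φ s ≠ 0 ∧ φ s * x = φ r) {z : D}
    (hz : z ∈ Subring.center D) : φ z ∈ Subring.center F := by
  refine Subring.mem_center_iff.2 fun x => ?_
  obtain ⟨s, r, hs, hsr⟩ := hfrac x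
  refine mul_left_cancel₀ hs ?_
  rw [← mul_assoc, hsr, ← map_mul, ← (commute_of_mem_center hz r).eq, map_mul, ← hsr, ← mul_assoc,
    ← mul_assoc, ← map_mul, ← map_mul, (commute_of_mem_center hz s).eq]

theorem hasCentralFractions_range [NoZeroDivisors D]
    [Algebra.IsAlgebraic (Subring.center D) D]
    (hφ : Function.Injective φ) (hfrac : ∀ x : F, ∃ s r : D, φ s ≠ 0 ∧ φ s * x = φ r) :
    HasCentralFractions φ.range := by
  intro x
  obtain ⟨s, r, hs, hsr⟩ := hfrac x
  obtain ⟨b, hb0, hbc⟩ := exists_mul_mem_center ((map_ne_zero_iff φ hφ).1 hs)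
  refine ⟨φ (b * s), ⟨_, rfl⟩, (map_ne_zero_iff φ hφ).2 hb0, map_mem_center hfrac hbc, b * r, ?_⟩
  rw [map_mul, map_mul, ← hsr, mul_assoc]

theorem finite_center_of_fractions [Module.Finite (Subring.center D) D]
    (hfrac : ∀ x : F, ∃ s r : D, φ s ≠ 0 ∧ φ s * x = φ r)
    (hF : HasCentralFractions φ.range) : Module.Finite (Subring.center F) F := by
  obtain ⟨S, hS⟩ := Module.Finite.fg_top (R := Subring.center D) (M := D)
  let P : Submodule (Subring.center F) F := Submodule.span _ (φ '' (S : Set D))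
  have smul_mem {c y : F} (hc : c ∈ Subring.center F) (hy : y ∈ P) : c * y ∈ P :=
    P.smul_mem (⟨c, hc⟩ : Subring.center F) hy
  have hmem (t : D) : φ t ∈ P := by
    have ht : t ∈ Submodule.span (Subring.center D) (S : Set D) := hS ▸ Submodule.mem_top
    induction ht using Submodule.span_induction with
    | mem t ht => exact Submodule.subset_span ⟨t, ht, rfl⟩
    | zero => exact map_zero φ ▸ P.zero_mem
    | add x y _ _ hx hy => exact map_add φ x y ▸ P.add_mem hx hy
    | smul c t _ ht => exact map_mul φ (c : D) t ▸ smul_mem (map_mem_center hfrac c.2) ht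
  refine ⟨Submodule.fg_def.2 ⟨φ '' (S : Set D), S.finite_toSet.image _, top_unique fun x _ => ?_⟩⟩
  obtain ⟨z, -, hz0, hzc, t, ht⟩ := hF x
  rw [← inv_mul_cancel_left₀ hz0 x, ← ht]
  exact smul_mem (Set.inv_mem_center hzc) (hmem t)

theorem exists_divisionRing_hasCentralFractions {A : Type*} [CommRing A] {D : Type w} [Ring D]
    [Algebra A D] [Nontrivial D] [NoZeroDivisors D] [Module.Finite (Subring.center D) D] :
    ∃ (F : Type w) (_ : DivisionRing F) (_ : Algebra A F) (φ : D →ₐ[A] F),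
      Function.Injective φ ∧ Module.Finite (Subring.center F) F ∧
        HasCentralFractions (φ : D →+* F).range := by
  obtain ⟨_⟩ : Nonempty (OreLocalization.OreSet D⁰) := by
    rw [OreLocalization.nonempty_oreSet_iff_of_noZeroDivisors]
    intro r s
    obtain ⟨b, hb0, hbc⟩ := exists_mul_mem_center (nonZeroDivisors.ne_zero s.2)
    exact ⟨r * b, ⟨b * s, mem_nonZeroDivisors_of_ne_zero hb0⟩, by
      rw [mul_assoc r]
      exact (commute_of_mem_center hbc r).eq⟩
  let φ : D →ₐ[A] OreLocalization D⁰ D :=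
    { OreLocalization.numeratorRingHom with commutes' := fun a => rfl }
  have hφ : Function.Injective φ := OreLocalization.numeratorHom_inj inf_le_left
  have hfrac (x : OreLocalization D⁰ D) : ∃ s r : D, φ s ≠ 0 ∧ φ s * x = φ r := by
    induction x using OreLocalization.ind with
    | _ r s =>
      exact ⟨s, r, (map_ne_zero_iff φ hφ).2 (nonZeroDivisors.ne_zero s.2),
        OreLocalization.mul_cancel⟩
  have hF : HasCentralFractions (φ : D →+* OreLocalization D⁰ D).range :=
    hasCentralFractions_range hφ hfrac
  exact ⟨OreLocalization D⁰ D, inferInstance, inferInstance, φ, hφ,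
    finite_center_of_fractions hfrac hF, hF⟩

end Fractions

/-! ## Division rings of quantum tori -/

section TorusFractions

theorem map_spanOn {A E E' G : Type*} [Semiring A] [AddCommMonoid E] [Module A E]
    [AddCommMonoid E'] [Module A E'] (φ : E →ₗ[A] E') (m : G → E) (S : Set G) :
    (spanOn A m S).map φ = spanOn A (φ ∘ m) S := by
  rw [spanOn, spanOn, Submodule.map_span, Set.image_comp]

namespace IsTwistedBasis

section

variable {A E E' G : Type*} [CommRing A] [Ring E] [Algebra A E] [Ring E'] [Algebra A E']
variable [AddMonoid G] {c : G → G → Aˣ} {m : G → E}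

/-- The twisted group algebra with basis `m`. -/
def subalgebra (hm : IsTwistedBasis c m) : Subalgebra A E :=
  (spanOn A m Set.univ).toSubalgebra (hm.one ▸ mem_spanOn m (Set.mem_univ 0)) fun _ _ =>
    hm.mul_mem fun _ _ _ _ => Set.mem_univ _

theorem comp_iff {φ : E →ₐ[A] E'} (hφ : Function.Injective φ) :
    IsTwistedBasis c (φ ∘ m) ↔ IsTwistedBasis c m where
  mp h := by
    refine ⟨hφ ?_, fun f g => hφ ?_, .of_comp φ.toLinearMap h.linearIndependent⟩
    · exact h.one.trans (map_one φ).symm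
    · rw [map_mul, map_smul]
      exact h.mul f g
  mpr h := by
    refine ⟨?_, fun f g => ?_, h.linearIndependent.map' φ.toLinearMap (LinearMap.ker_eq_bot.2 hφ)⟩
    · rw [Function.comp_apply, h.one, map_one]
    · simp only [Function.comp_apply, ← map_mul, h.mul, map_smul]

theorem noZeroDivisors [NoZeroDivisors A] {Γ : Type*} [AddCommMonoid Γ] [LinearOrder Γ]
    [IsOrderedCancelAddMonoid Γ] (hm : IsTwistedBasis c m) (htop : spanOn A m Set.univ = ⊤)
    {d : G →+ Γ} (hd : Function.Injective d) : NoZeroDivisors E where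
  eq_zero_or_eq_zero_of_mul_eq_zero {x y} hxy := by
    by_contra! hne
    obtain ⟨_, _, hh, hx⟩ := exists_hasLeadingForm hm.linearIndependent d
      (htop ▸ Submodule.mem_top) hne.1
    obtain ⟨_, _, hk, hy⟩ := exists_hasLeadingForm hm.linearIndependent d
      (htop ▸ Submodule.mem_top) hne.2
    obtain ⟨f, rfl, a, rfl⟩ := hx.exists_smul_eq hd hh
    obtain ⟨g, rfl, b, rfl⟩ := hy.exists_smul_eq hd hk
    have hlead := hx.mul hm hy
    rw [hxy, smul_mul_smul_comm, hm.mul, smul_smul] at hlead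
    have hzero := hlead.eq_zero_of_mem hm.linearIndependent (S := ∅) (by simp) (zero_mem _)
    have hab : a * b = 0 := (c f g).isUnit.mul_left_eq_zero.1
      (hm.linearIndependent.smul_left_injective _ (hzero.trans (zero_smul A _).symm))
    rcases mul_eq_zero.1 hab with rfl | rfl
    · exact hh (zero_smul _ _)
    · exact hk (zero_smul _ _)

end

section Center

variable {A E G : Type*} [CommRing A] [Ring E] [Algebra A E] [AddCommMonoid G]
variable {c : G → G → Aˣ} {m : G → E}

theorem mem_center (hm : IsTwistedBasis c m) (htop : spanOn A m Set.univ = ⊤) {z : G}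
    (hz : ∀ f, c z f = c f z) : m z ∈ Subring.center E := by
  have hmul : LinearMap.mulRight A (m z) = LinearMap.mulLeft A (m z) := by
    refine LinearMap.ext_on htop ?_
    rintro _ ⟨f, -, rfl⟩
    rw [LinearMap.mulRight_apply, LinearMap.mulLeft_apply, hm.mul, hm.mul, hz, add_comm]
  exact Subring.mem_center_iff.2 fun y => LinearMap.congr_fun hmul y

theorem finite_center (hm : IsTwistedBasis c m) (htop : spanOn A m Set.univ = ⊤) {S : Set G}
    (hS : S.Finite) (h : ∀ g, ∃ s ∈ S, ∃ z, z + s = g ∧ ∀ f, c z f = c f z) :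
    Module.Finite (Subring.center E) E := by
  refine ⟨Submodule.fg_def.2 ⟨m '' S, hS.image m, Submodule.eq_top_iff'.2 fun x => ?_⟩⟩
  have hA (a : A) : algebraMap A E a ∈ Subring.center E :=
    Subring.mem_center_iff.2 fun y => (Algebra.commutes a y).symm
  have hx : x ∈ Submodule.span A (m '' Set.univ) := htop.ge Submodule.mem_top
  have smul_mem {a y : E} (ha : a ∈ Subring.center E)
      (hy : y ∈ Submodule.span (Subring.center E) (m '' S)) :
      a * y ∈ Submodule.span (Subring.center E) (m '' S) :=
    Submodule.smul_mem _ (⟨a, ha⟩ : Subring.center E) hy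
  induction hx using Submodule.span_induction with
  | mem y hy =>
    obtain ⟨g, -, rfl⟩ := hy
    obtain ⟨s, hs, z, rfl, hz⟩ := h g
    have hmul : m (z + s) = algebraMap A E ((c z s)⁻¹ : Aˣ) * (m z * m s) := by
      rw [← Algebra.smul_def, hm.mul, smul_smul, Units.inv_mul, one_smul]
    rw [hmul]
    exact smul_mem (hA _) (smul_mem (hm.mem_center htop hz)
      (Submodule.subset_span ⟨s, hs, rfl⟩))
  | zero => exact Submodule.zero_mem _
  | add x y _ _ hx hy => exact Submodule.add_mem _ hx hy
  | smul a x _ hx => exact Algebra.smul_def a x ▸ smul_mem (hA a) hx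

end Center

section Torus

theorem torusCocycle_comm_of_dvd {A : Type*} [CommRing A] {q : Aˣ} {ℓ : ℕ} (hq : q ^ ℓ = 1)
    (z f : ℤ × ℤ) : torusCocycle q (ℓ * z.1, ℓ * z.2) f = torusCocycle q f (ℓ * z.1, ℓ * z.2) := by
  have hone (n : ℤ) : q ^ (ℓ * n) = 1 := by rw [zpow_mul, zpow_natCast, hq, one_zpow]
  have hl : ℓ * z.1 * f.2 - ℓ * z.2 * f.1 = ℓ * (z.1 * f.2 - z.2 * f.1) := by ring
  have hr : f.1 * (ℓ * z.2) - f.2 * (ℓ * z.1) = ℓ * (f.1 * z.2 - f.2 * z.1) := by ring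
  simp only [torusCocycle, hl, hr, hone]

theorem finite_center_of_torusCocycle {A E : Type*} [CommRing A] [Ring E] [Algebra A E] {q : Aˣ}
    {m : ℤ × ℤ → E} (hm : IsTwistedBasis (torusCocycle q) m) (htop : spanOn A m Set.univ = ⊤)
    {ℓ : ℕ} (hℓ : 0 < ℓ) (hq : q ^ ℓ = 1) : Module.Finite (Subring.center E) E := by
  have hℓ' : (0 : ℤ) < ℓ := Int.natCast_pos.2 hℓ
  refine hm.finite_center htop (Set.finite_Icc ((0 : ℤ), (0 : ℤ)) (ℓ, ℓ)) fun g =>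
    ⟨(g.1 % ℓ, g.2 % ℓ), ⟨⟨?_, ?_⟩, ?_, ?_⟩, (ℓ * (g.1 / ℓ), ℓ * (g.2 / ℓ)), ?_,
      torusCocycle_comm_of_dvd hq (g.1 / ℓ, g.2 / ℓ)⟩
  · exact Int.emod_nonneg _ hℓ'.ne'
  · exact Int.emod_nonneg _ hℓ'.ne'
  · exact (Int.emod_lt_of_pos _ hℓ').le
  · exact (Int.emod_lt_of_pos _ hℓ').le
  · exact Prod.ext (Int.mul_ediv_add_emod _ _) (Int.mul_ediv_add_emod _ _)

theorem exists_divisionRing {A : Type*} {E : Type w} [CommRing A] [IsDomain A] [Ring E]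
    [Algebra A E] {q : Aˣ} {m : ℤ × ℤ → E} (hm : IsTwistedBasis (torusCocycle q) m) {ℓ : ℕ}
    (hℓ : 0 < ℓ) (hq : q ^ ℓ = 1) :
    ∃ (F : Type w) (_ : DivisionRing F) (_ : Algebra A F) (m' : ℤ × ℤ → F)
      (hm' : IsTwistedBasis (torusCocycle q) m'),
      Module.Finite (Subring.center F) F ∧ HasCentralFractions hm'.subalgebra.toSubring := by
  let D := hm.subalgebra
  let mD : ℤ × ℤ → D := fun f => ⟨m f, mem_spanOn m (Set.mem_univ f)⟩
  have hmD : IsTwistedBasis (torusCocycle q) mD :=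
    (comp_iff (φ := D.val) Subtype.val_injective).1 hm
  have htop : spanOn A mD Set.univ = ⊤ := by
    refine Submodule.map_injective_of_injective (f := D.val.toLinearMap)
      Subtype.val_injective ?_
    rw [map_spanOn, Submodule.map_top]
    exact (Submodule.range_subtype _).symm
  have : Nontrivial D := ⟨mD 0, 0, hmD.linearIndependent.ne_zero 0⟩
  have : NoZeroDivisors D := hmD.noZeroDivisors htop lexDegree_injective
  have : Module.Finite (Subring.center D) D := hmD.finite_center_of_torusCocycle htop hℓ hq
  obtain ⟨F, hF, hAF, φ, hφ, hfin, hfrac⟩ :=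
    exists_divisionRing_hasCentralFractions (A := A) (D := D)
  have hφm := (comp_iff hφ).2 hmD
  have hrange : (φ : D →+* F).range = hφm.subalgebra.toSubring := by
    have hspan := map_spanOn φ.toLinearMap mD Set.univ
    rw [htop, Submodule.map_top] at hspan
    exact SetLike.ext fun x => SetLike.ext_iff.1 hspan x
  exact ⟨F, hF, hAF, φ ∘ mD, hφm, hfin, hrange ▸ hfrac⟩

end Torus

end IsTwistedBasis

end TorusFractions

/-! ## Orders in division rings of quantum tori -/

section TorusOrders

theorem finite_forall_coord_le (δ : Fin 4 → ℤ) :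
    {g : ℤ × ℤ | ∀ i, (![.fst ℤ ℤ, -.fst ℤ ℤ, .snd ℤ ℤ, -.snd ℤ ℤ] : Fin 4 → ℤ × ℤ →+ ℤ) i g
      ≤ δ i}.Finite := by
  refine (Set.finite_Icc (-δ 1, -δ 3) (δ 0, δ 2)).subset fun g hg => ?_
  have h0 : g.1 ≤ δ 0 := hg 0
  have h1 : -g.1 ≤ δ 1 := hg 1
  have h2 : g.2 ≤ δ 2 := hg 2
  have h3 : -g.2 ≤ δ 3 := hg 3
  exact ⟨⟨neg_le.1 h1, neg_le.1 h3⟩, h0, h2⟩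

variable {A : Type*} [CommRing A] {F : Type*} [DivisionRing F] [Algebra A F]

theorem inv_mon_mem_pairTorus (u v : F) (p : ℤ × ℤ) : (mon u v p)⁻¹ ∈ pairTorus A u v := by
  rw [mon, mul_inv_rev, ← zpow_neg, ← zpow_neg, pairTorus_comm]
  exact mon_mem_pairTorus v u (-p.2, -p.1)

namespace QuasiComm

variable {s : Aˣ} {u v : F} {ℓ : ℕ}

theorem commute_mon (h : QuasiComm s u v) (hs : s ^ ℓ = 1) (f : ℤ × ℤ) :
    Commute (mon u v (ℓ, ℓ)) (mon u v f) := by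
  have hone (i : ℤ) : s ^ (-(ℓ * i)) = 1 := by
    rw [← mul_neg, zpow_mul, zpow_natCast, hs, one_zpow]
  rw [Commute, SemiconjBy, h.mon_mul, h.mon_mul, add_comm f]
  simp only [hone, mul_comm f.1]

theorem commute_of_mem_pairTorus (h : QuasiComm s u v) (hs : s ^ ℓ = 1) {x : F}
    (hx : x ∈ pairTorus A u v) : Commute (mon u v (ℓ, ℓ)) x := by
  have hu : Commute (mon u v (ℓ, ℓ)) u := by simpa [mon] using h.commute_mon hs (1, 0)
  have hv : Commute (mon u v (ℓ, ℓ)) v := by simpa [mon] using h.commute_mon hs (0, 1)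
  have hle : pairTorus A u v ≤ Subalgebra.centralizer A {mon u v (ℓ, ℓ)} := by
    simp only [pairTorus_le, Subalgebra.mem_centralizer_iff, Set.mem_singleton_iff, forall_eq]
    exact ⟨hu, hu.inv_right₀, hv, hv.inv_right₀⟩
  exact Subalgebra.mem_centralizer_iff A |>.1 (hle hx) _ rfl

theorem eventually_mon_pow_mul_mem (h : QuasiComm s u v) (hli : LinearIndependent A (mon u v))
    (hℓ : 0 < ℓ) {B : Subalgebra A F} (hu : u ∈ B) (hv : v ∈ B) {x : F}
    (hx : x ∈ pairTorus A u v) : ∀ᶠ N in Filter.atTop, mon u v (ℓ, ℓ) ^ N * x ∈ B := by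
  rw [← Subalgebra.mem_toSubmodule, ← h.spanOn_mon] at hx
  refine eventually_mem_of_mem_spanOn (T := fun N => LinearMap.mulLeft A (mon u v (ℓ, ℓ) ^ N))
    (P := fun _ => Subalgebra.toSubmodule B) (fun f _ => ?_) hx
  filter_upwards [Filter.eventually_ge_atTop (f.1.natAbs + f.2.natAbs)] with N hN
  have hNℓ : (N : ℤ) ≤ N * ℓ := by exact_mod_cast Nat.le_mul_of_pos_right N hℓ
  obtain ⟨i, hi⟩ := Int.eq_ofNat_of_zero_le (show 0 ≤ N * (ℓ : ℤ) + f.1 by lia)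
  obtain ⟨j, hj⟩ := Int.eq_ofNat_of_zero_le (show 0 ≤ N * (ℓ : ℤ) + f.2 by lia)
  obtain ⟨r, hr⟩ := (h.isTwistedBasis hli).exists_pow_eq (ℓ, ℓ) N
  have hmon : mon u v (N • ((ℓ : ℤ), (ℓ : ℤ)) + f) = u ^ i * v ^ j := by
    simp [mon, hi, hj]
  rw [LinearMap.mulLeft_apply, hr, smul_mul_assoc, h.mon_mul, hmon]
  exact B.smul_mem (B.smul_mem (mul_mem (pow_mem hu i) (pow_mem hv j)) _) _

theorem mon_ne_zero (h : QuasiComm s u v) (p : ℤ × ℤ) : mon u v p ≠ 0 :=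
  mul_ne_zero (zpow_ne_zero _ h.left_ne_zero) (zpow_ne_zero _ h.right_ne_zero)

/-- Inverting the central monomial `(uv)^ℓ` of `B` turns `R` into a ring containing the torus. -/
theorem mem_pairTorus_of_mul_mem (h : QuasiComm s u v) (hli : LinearIndependent A (mon u v))
    (hA : ∀ a b r : A, a ≠ 0 → r ≠ 0 → (∀ n, a ^ n ∣ r * b ^ n) → a ∣ b) (hs : s ^ ℓ = 1)
    (hℓ : 0 < ℓ) {B : Subalgebra A F} (hu : u ∈ B) (hv : v ∈ B) (hBT : B ≤ pairTorus A u v)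
    (hB : HasCentralFractions B.toSubring) {R : Subring F} (hBR : B.toSubring ≤ R) {e : F}
    (he : e ∈ Subring.center F) (he0 : e ≠ 0) (heR : ∀ y ∈ R, e * y ∈ B) {x : F} (hx : x ∈ R) :
    x ∈ pairTorus A u v := by
  have mem_span {y : F} (hy : y ∈ pairTorus A u v) : y ∈ spanOn A (mon u v) Set.univ :=
    h.spanOn_mon.ge hy
  set w := mon u v (ℓ, ℓ)
  have hwB : w ∈ B := mul_mem (by simpa using pow_mem hu ℓ) (by simpa using pow_mem hv ℓ)
  have hwc : w ∈ Subring.center F :=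
    hB.mem_center_of_commute fun b hb => h.commute_of_mem_pairTorus hs (hBT hb)
  refine h.spanOn_mon.le ((h.isTwistedBasis hli).mem_of_mul_mem hA lexDegree_injective
    finite_forall_coord_le (R := adjoinInv R w (hBR hwB) hwc) (e := e) ?_ ?_ he0
    (fun y _ => commute_of_mem_center he y) ?_ ?_)
  · intro y hy
    filter_upwards [h.eventually_mon_pow_mul_mem hli hℓ hu hv (h.spanOn_mon.le hy)] with N hN
    exact hBR hN
  · exact mem_span (hBT (mul_one e ▸ heR 1 (one_mem R)))
  · intro y hy
    obtain ⟨N, hN⟩ := Filter.Eventually.exists hy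
    have hwN : (w ^ N)⁻¹ * (e * (w ^ N * y)) = e * y := by
      rw [← mul_assoc e, ← (commute_of_mem_center (pow_mem hwc N) e).eq, mul_assoc,
        inv_mul_cancel_left₀ (pow_ne_zero N (h.mon_ne_zero _))]
    rw [← hwN, ← inv_pow]
    exact mem_span (mul_mem (pow_mem (inv_mon_mem_pairTorus u v _) N) (hBT (heR _ hN)))
  · exact .of_forall fun N => mul_mem (pow_mem (hBR hwB) N) hx

theorem linearIndependent_mon_symm (h : QuasiComm s u v) (hli : LinearIndependent A (mon u v)) :
    LinearIndependent A (mon v u) := by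
  convert (hli.comp Prod.swap Prod.swap_injective).units_smul
    (fun p : ℤ × ℤ => (s ^ (p.2 * p.1))⁻¹) using 1
  ext p
  change mon v u p = (((s ^ (p.2 * p.1))⁻¹ : Aˣ) : A) • (u ^ p.2 * v ^ p.1)
  rw [h.zpow_mul_zpow, smul_smul, Units.inv_mul, one_smul, mon]

theorem linearIndependent_mon_of_nat (h : QuasiComm s u v)
    (hli : LinearIndependent A fun p : ℕ × ℕ => u ^ p.1 * v ^ p.2) :
    LinearIndependent A (mon u v) := by
  refine linearIndependent_iff_finset_linearIndependent.2 fun S => ?_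
  let N : ℕ := S.sup fun p => p.1.natAbs + p.2.natAbs
  have hN (p : S) : p.1.1.natAbs + p.1.2.natAbs ≤ N :=
    Finset.le_sup (f := fun p : ℤ × ℤ => p.1.natAbs + p.2.natAbs) p.2
  let toNat (p : S) : ℕ × ℕ := ((p.1.1 + N).toNat, (p.1.2 + N).toNat)
  have htoNat : Function.Injective toNat := by
    intro p p' hpp
    have h1 := congrArg Prod.fst hpp
    have h2 := congrArg Prod.snd hpp
    have hp := hN p
    have hp' := hN p'
    refine Subtype.ext (Prod.ext ?_ ?_) <;> simp only [toNat] at h1 h2 <;> lia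
  have hcomp (p : S) : u ^ N * (mon u v p * v ^ N) = u ^ (toNat p).1 * v ^ (toNat p).2 := by
    have hp := hN p
    have hi : (((p.1.1 + N).toNat : ℕ) : ℤ) = N + p.1.1 := by lia
    have hj : (((p.1.2 + N).toNat : ℕ) : ℤ) = p.1.2 + N := by lia
    rw [← zpow_natCast u (toNat p).1, ← zpow_natCast v (toNat p).2, hi, hj,
      zpow_add₀ h.left_ne_zero, zpow_add₀ h.right_ne_zero, zpow_natCast, zpow_natCast, mon]
    simp only [mul_assoc]
  refine .of_comp (LinearMap.mulLeft A (u ^ N) ∘ₗ LinearMap.mulRight A (v ^ N)) ?_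
  have hnat := hli.comp toNat htoNat
  rw [show (fun p : ℕ × ℕ => u ^ p.1 * v ^ p.2) ∘ toNat = _ from (funext hcomp).symm] at hnat
  exact hnat

end QuasiComm

end TorusOrders

/-! ## Algebras with independent ordered monomials -/

section PBW

theorem dvd_of_isCompletelyIntegrallyClosed {A : Type*} [CommRing A] [IsDomain A]
    (hA : IsCompletelyIntegrallyClosed A) {a b r : A} (ha : a ≠ 0) (hr : r ≠ 0)
    (h : ∀ n, a ^ n ∣ r * b ^ n) : a ∣ b := by
  have ha' : algebraMap A (FractionRing A) a ≠ 0 := by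
    rwa [Ne, IsFractionRing.to_map_eq_zero_iff]
  have hmem : algebraMap A (FractionRing A) b / algebraMap A (FractionRing A) a ∈
      completeIntegralClosure A (FractionRing A) := by
    refine ⟨r, mem_nonZeroDivisors_of_ne_zero hr, fun n => ?_⟩
    obtain ⟨t, ht⟩ := h n
    refine ⟨t, ?_⟩
    rw [Algebra.smul_def, div_pow, ← mul_div_assoc, eq_div_iff (pow_ne_zero _ ha'), ← map_pow,
      ← map_pow, ← map_mul, ← map_mul, ht, mul_comm]
  have hbot : completeIntegralClosure A (FractionRing A) = ⊥ := hA
  rw [hbot, Algebra.mem_bot] at hmem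
  obtain ⟨t, ht⟩ := hmem
  refine ⟨t, IsFractionRing.injective A (FractionRing A) ?_⟩
  rw [map_mul, ht, mul_div_cancel₀ _ ha']

variable {A : Type*} [CommRing A] {F : Type*} [DivisionRing F] [Algebra A F] {q : Aˣ}
variable {x1 x2 y1 y2 : F} {ℓ : ℕ}

namespace A2Relations

section

variable [Nontrivial A] (h : A2Relations q x1 x2 y1 y2)
  (hli : LinearIndependent A (pbwMonomial x1 x2 y1 y2))
include h hli

theorem quasiComm_x1_x2 : QuasiComm (q ^ (2 : ℤ)) x1 x2 := (h.pentagon hli).quasiComm 1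

theorem quasiComm_y1_x2 : QuasiComm (q ^ (-2 : ℤ)) y1 x2 := (h.pentagon hli).quasiComm_add_two 1

theorem quasiComm_y2_x1 : QuasiComm (q ^ (2 : ℤ)) y2 x1 := (h.pentagon hli).quasiComm 0

theorem linearIndependent_mon_x1_x2 : LinearIndependent A (mon x1 x2) := by
  refine (h.quasiComm_x1_x2 hli).linearIndependent_mon_of_nat ?_
  have hx := hli.comp (fun p : ℕ × ℕ => (⟨(0, p.1, p.2, 0), by simp⟩ : PBWIndex))
    fun p p' hp => by simpa [Prod.ext_iff] using hp
  simpa [Function.comp_def, pbwMonomial] using hx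

theorem linearIndependent_mon_y1_x2 : LinearIndependent A (mon y1 x2) := by
  refine (h.quasiComm_y1_x2 hli).linearIndependent_mon_of_nat ?_
  have hy := hli.comp (fun p : ℕ × ℕ => (⟨(p.1, 0, p.2, 0), by simp⟩ : PBWIndex))
    fun p p' hp => by simpa [Prod.ext_iff] using hp
  simpa [Function.comp_def, pbwMonomial] using hy

theorem linearIndependent_mon_x1_y2 : LinearIndependent A (mon x1 y2) := by
  refine (h.quasiComm_y2_x1 hli).symm.linearIndependent_mon_of_nat ?_
  have hy := hli.comp (fun p : ℕ × ℕ => (⟨(0, p.1, 0, p.2), by simp⟩ : PBWIndex))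
    fun p p' hp => by simpa [Prod.ext_iff] using hp
  simpa [Function.comp_def, pbwMonomial] using hy

theorem adjoin_eq_inf_pairTorus : Algebra.adjoin A {x1, x2, y1, y2} =
    pairTorus A x1 x2 ⊓ pairTorus A y1 x2 ⊓ pairTorus A x1 y2 := by
  have hx := h.quasiComm_x1_x2 hli
  have hli' := h.linearIndependent_mon_x1_x2 hli
  apply le_antisymm
  · have hmem (i : Fin 5) : Algebra.adjoin A {x1, x2, y1, y2} ≤ pairTorus A
        (![y2, x1, x2, y1, fifthVar q y1 y2] i) (![y2, x1, x2, y1, fifthVar q y1 y2] (i + 1)) := by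
      have hz := (h.pentagon hli).mem_pairTorus i
      refine Algebra.adjoin_le ?_
      rintro _ (rfl | rfl | rfl | rfl)
      exacts [hz 1, hz 2, hz 3, hz 0]
    exact le_inf (le_inf (hmem 1) (pairTorus_comm (A := A) x2 y1 ▸ hmem 2))
      (pairTorus_comm (A := A) y2 x1 ▸ hmem 0)
  · rintro x ⟨⟨hx12, hxy1⟩, hxy2⟩
    exact h.mem_adjoin_of_mem_pairTorus hx (h.quasiComm_y1_x2 hli) (h.quasiComm_y2_x1 hli) hli'
      (hx.linearIndependent_mon_symm hli') hx12 hxy1 hxy2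

theorem clusterAlgebra_eq_adjoin (hq : q ^ ℓ = 1) :
    clusterAlgebra q (signedSeed ℓ q 1 x1 x2) = Algebra.adjoin A {x1, x2, y1, y2} :=
  (h.pentagon hli).clusterAlgebra_eq hq 1

theorem clusterAlgebra_eq_upperClusterAlgebra (hq : q ^ ℓ = 1) :
    clusterAlgebra q (signedSeed ℓ q 1 x1 x2) = upperClusterAlgebra q (signedSeed ℓ q 1 x1 x2) := by
  refine le_antisymm ((h.pentagon hli).clusterAlgebra_le_upper hq 1) ?_
  rw [h.clusterAlgebra_eq_adjoin hli hq, h.adjoin_eq_inf_pairTorus hli]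
  exact (h.pentagon hli).upper_le_pairTorus hq 1

theorem hasCentralFractions_adjoin (hq : q ^ ℓ = 1) (hℓ : 0 < ℓ)
    (hT : HasCentralFractions (pairTorus A x1 x2).toSubring) :
    HasCentralFractions (Algebra.adjoin A {x1, x2, y1, y2}).toSubring := by
  have hx := h.quasiComm_x1_x2 hli
  have hq' : (q ^ (2 : ℤ)) ^ ℓ = 1 := by rw [← zpow_natCast, zpow_comm, zpow_natCast, hq, one_zpow]
  refine hT.of_pow_mul_mem (hx.mon_ne_zero (ℓ, ℓ))
    (hT.mem_center_of_commute fun _ ht => hx.commute_of_mem_pairTorus hq' ht) fun t ht => ?_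
  exact hx.eventually_mon_pow_mul_mem (h.linearIndependent_mon_x1_x2 hli) hℓ
    (Algebra.subset_adjoin (by simp)) (Algebra.subset_adjoin (by simp)) ht

end

theorem isMaximalOrderIn_adjoin [IsDomain A] (h : A2Relations q x1 x2 y1 y2)
    (hli : LinearIndependent A (pbwMonomial x1 x2 y1 y2)) (hA : IsCompletelyIntegrallyClosed A)
    (hq : q ^ ℓ = 1) (hℓ : 0 < ℓ)
    (hB : HasCentralFractions (Algebra.adjoin A {x1, x2, y1, y2}).toSubring) :
    IsMaximalOrderIn (Algebra.adjoin A {x1, x2, y1, y2}).toSubring := by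
  have hq' (n : ℤ) : (q ^ n) ^ ℓ = 1 := by
    rw [← zpow_natCast, zpow_comm, zpow_natCast, hq, one_zpow]
  have hdvd (a b r : A) (ha : a ≠ 0) (hr : r ≠ 0) (habr : ∀ n, a ^ n ∣ r * b ^ n) : a ∣ b :=
    dvd_of_isCompletelyIntegrallyClosed hA ha hr habr
  have hgen {x : F} (hx : x ∈ ({x1, x2, y1, y2} : Set F)) : x ∈ Algebra.adjoin A {x1, x2, y1, y2} :=
    Algebra.subset_adjoin hx
  have hinf := h.adjoin_eq_inf_pairTorus hli
  refine hB.isMaximalOrderIn fun R hBR e hec he0 heR x hx => ?_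
  rw [Subalgebra.mem_toSubring, hinf]
  refine ⟨⟨?_, ?_⟩, ?_⟩
  · exact (h.quasiComm_x1_x2 hli).mem_pairTorus_of_mul_mem (h.linearIndependent_mon_x1_x2 hli)
      hdvd (hq' _) hℓ (hgen (by simp)) (hgen (by simp))
      (hinf.trans_le (inf_le_left.trans inf_le_left)) hB hBR hec he0 heR hx
  · exact (h.quasiComm_y1_x2 hli).mem_pairTorus_of_mul_mem (h.linearIndependent_mon_y1_x2 hli)
      hdvd (hq' _) hℓ (hgen (by simp)) (hgen (by simp))
      (hinf.trans_le (inf_le_left.trans inf_le_right)) hB hBR hec he0 heR hx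
  · exact (h.quasiComm_y2_x1 hli).symm.mem_pairTorus_of_mul_mem
      (h.linearIndependent_mon_x1_y2 hli) hdvd (by rw [inv_pow, hq', inv_one]) hℓ
      (hgen (by simp)) (hgen (by simp)) (hinf.trans_le inf_le_right) hB hBR hec he0 heR hx

end A2Relations

end PBW

/-! ## The cluster algebra of type `A₂` -/

section Main

theorem IsTwistedBasis.subalgebra_eq_pairTorus {A : Type*} [CommRing A] [Nontrivial A] {F : Type*}
    [DivisionRing F] [Algebra A F] {q : Aˣ} {m : ℤ × ℤ → F}
    (hm : IsTwistedBasis (torusCocycle q) m) :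
    hm.subalgebra = pairTorus A (m (1, 0)) (m (0, 1)) := by
  refine Subalgebra.toSubmodule_injective ?_
  rw [← hm.quasiComm.spanOn_mon]
  refine le_antisymm (spanOn_le.2 fun p _ => ?_) (spanOn_le.2 fun p _ => ?_)
  · have hp : m p = ((q ^ (-(p.1 * p.2)) : Aˣ) : A) • mon (m (1, 0)) (m (0, 1)) p := by
      rw [hm.mon_eq_smul, smul_smul, ← Units.val_mul, ← zpow_add, neg_add_cancel, zpow_zero,
        Units.val_one, one_smul]
    rw [hp]
    exact Submodule.smul_mem _ _ (mem_spanOn _ (Set.mem_univ p))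
  · rw [hm.mon_eq_smul]
    exact Submodule.smul_mem _ _ (mem_spanOn m (Set.mem_univ p))

theorem isMaximalOrder_presentedAlgebra {A : Type*} [CommRing A] [IsDomain A] {q : Aˣ} {ℓ : ℕ}
    (hA : IsCompletelyIntegrallyClosed A) (hq : q ^ ℓ = 1) (hℓ : 0 < ℓ) :
    IsMaximalOrder (PresentedAlgebra q) := by
  obtain ⟨F, _, _, m, hm, hfin, hfrac⟩ :=
    (isTwistedBasis_twistedTranslation q).exists_divisionRing hℓ hq
  have hrel := hm.a2Relations
  have hli := hm.linearIndependent_pbwMonomial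
  rw [hm.subalgebra_eq_pairTorus] at hfrac
  refine ⟨Subring.center F, F, inferInstance, inferInstance, inferInstance, ⟨fun x hx => ?_⟩,
    inferInstance, hfin, hrel.toHom, hrel.toHom_injective hli, ?_⟩
  · rw [Algebra.mem_bot]
    exact ⟨⟨x, Subring.mem_center_iff.2 (Subalgebra.mem_center_iff.1 hx)⟩, rfl⟩
  · have hrange : (hrel.toHom : PresentedAlgebra q →+* F).range = (Algebra.adjoin A
        {m (1, 0), m (0, 1), m (-1, 1) + m (-1, 0), m (1, -1) + m (0, -1)}).toSubring :=
      congrArg Subalgebra.toSubring hrel.range_toHom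
    rw [hrange]
    exact hrel.isMaximalOrderIn_adjoin hli hA hq hℓ
      (hrel.hasCentralFractions_adjoin hli hq hℓ hfrac)

namespace IsToricFrame

variable {A : Type*} [CommRing A] [Nontrivial A] {F : Type*} [DivisionRing F] [Algebra A F] {q : Aˣ}
variable {ℓ : ℕ} {M : (Fin 2 → ℤ) → F}

theorem clusterAlgebra_eq_adjoin (hM : IsToricFrame q (formA2 ℓ) M) (hq : q ^ ℓ = 1) :
    clusterAlgebra q (seedA2 ℓ M) = Algebra.adjoin A {M ![1, 0], M ![0, 1],
      M ![-1, 1] + M ![-1, 0], M ![1, -1] + M ![0, -1]} := by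
  have hm := hM.isTwistedBasis hq
  rw [hM.seedA2_eq hq]
  exact hm.a2Relations.clusterAlgebra_eq_adjoin hm.linearIndependent_pbwMonomial hq

theorem clusterAlgebra_eq_upperClusterAlgebra (hM : IsToricFrame q (formA2 ℓ) M)
    (hq : q ^ ℓ = 1) :
    clusterAlgebra q (seedA2 ℓ M) = upperClusterAlgebra q (seedA2 ℓ M) := by
  have hm := hM.isTwistedBasis hq
  rw [hM.seedA2_eq hq]
  exact hm.a2Relations.clusterAlgebra_eq_upperClusterAlgebra hm.linearIndependent_pbwMonomial hq

/-- The isomorphism `θ` from the presented algebra onto the cluster algebra of type `A₂`. -/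
noncomputable def clusterEquiv (hM : IsToricFrame q (formA2 ℓ) M) (hq : q ^ ℓ = 1) :
    PresentedAlgebra q ≃ₐ[A] clusterAlgebra q (seedA2 ℓ M) :=
  (AlgEquiv.ofInjective _ ((hM.isTwistedBasis hq).a2Relations.toHom_injective
    (hM.isTwistedBasis hq).linearIndependent_pbwMonomial)).trans
    (Subalgebra.equivOfEq _ _ ((hM.isTwistedBasis hq).a2Relations.range_toHom.trans
      (hM.clusterAlgebra_eq_adjoin hq).symm))

theorem coe_clusterEquiv (hM : IsToricFrame q (formA2 ℓ) M) (hq : q ^ ℓ = 1)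
    (x : PresentedAlgebra q) :
    (hM.clusterEquiv hq x : F) = (hM.isTwistedBasis hq).a2Relations.toHom x :=
  rfl

end IsToricFrame

theorem epsHalf_pow {k : Type u} [CommRing k] {K : Type w} [Field K] [Algebra k K] {ℓ : ℕ}
    (hℓ : 0 < ℓ) {ζ : K} (hζ : IsPrimitiveRoot ζ ℓ) : epsHalf k hℓ hζ ^ ℓ = 1 :=
  Units.ext (Subtype.ext hζ.pow_eq_one)

end Main

end RootCluster

theorem mainTheorem10_general {A : Type u} [CommRing A] (q : Aˣ) {ℓ : ℕ} (hq : q ^ ℓ = 1) :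
    (∀ (F : Type v) [DivisionRing F] [Algebra A F] (M : (Fin 2 → ℤ) → F),
      IsToricFrame q (formA2 ℓ) M →
        (∃ θ : PresentedAlgebra q ≃ₐ[A] clusterAlgebra q (seedA2 ℓ M),
          (θ (gen q Gen.x1) : F) = M ![1, 0] ∧
          (θ (gen q Gen.x2) : F) = M ![0, 1] ∧
          (θ (gen q Gen.y1) : F) = M ![-1, 1] + M ![-1, 0] ∧
          (θ (gen q Gen.y2) : F) = M ![1, -1] + M ![0, -1]) ∧
        clusterAlgebra q (seedA2 ℓ M) = upperClusterAlgebra q (seedA2 ℓ M) ∧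
        (∃ b : Module.Basis PBWIndex A (clusterAlgebra q (seedA2 ℓ M)),
          ∀ p, (b p : F) = pbwMonomial (M ![1, 0]) (M ![0, 1])
            (M ![-1, 1] + M ![-1, 0]) (M ![1, -1] + M ![0, -1]) p)) ∧
    (∃ b : Module.Basis PBWIndex A (PresentedAlgebra q),
      ∀ p, b p = pbwMonomial (gen q Gen.x1) (gen q Gen.x2) (gen q Gen.y1) (gen q Gen.y2) p) ∧
    (∀ [IsDomain A], 0 < ℓ → IsCompletelyIntegrallyClosed A →
      IsMaximalOrder (PresentedAlgebra q)) := by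
  refine ⟨fun F _ _ M hM => ?_, ⟨pbwBasis q, pbwBasis_apply q⟩,
    fun {_} hℓ hA => isMaximalOrder_presentedAlgebra hA hq hℓ⟩
  have : Nontrivial A := (algebraMap A F).domain_nontrivial
  have hrel := (hM.isTwistedBasis hq).a2Relations
  refine ⟨⟨hM.clusterEquiv hq, hrel.toHom_x1, hrel.toHom_x2, hrel.toHom_y1, hrel.toHom_y2⟩,
    hM.clusterAlgebra_eq_upperClusterAlgebra hq,
    (pbwBasis q).map (hM.clusterEquiv hq).toLinearEquiv, fun p => ?_⟩
  rw [Module.Basis.map_apply, pbwBasis_apply, AlgEquiv.toLinearEquiv_apply, hM.coe_clusterEquiv,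
    hrel.toHom_pbwMonomial]

theorem mainTheorem10 {k : Type u} [CommRing k] [IsDomain k] [CharZero k]
    {K : Type w} [Field K] [Algebra k K] [Algebra (FractionRing k) K]
    [IsScalarTower k (FractionRing k) K] [IsAlgClosure (FractionRing k) K]
    (ℓ : ℕ) (hℓ : 0 < ℓ) (ζ : K) (hζ : IsPrimitiveRoot ζ ℓ) :
    (∀ (F : Type v) [DivisionRing F] [Algebra (BaseRing k ζ) F] (M : (Fin 2 → ℤ) → F),
      IsToricFrame (epsHalf k hℓ hζ) (formA2 ℓ) M →
        (∃ θ : PresentedAlgebra (epsHalf k hℓ hζ) ≃ₐ[BaseRing k ζ]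
              clusterAlgebra (epsHalf k hℓ hζ) (seedA2 ℓ M),
          (θ (gen (epsHalf k hℓ hζ) Gen.x1) : F) = M ![1, 0] ∧
          (θ (gen (epsHalf k hℓ hζ) Gen.x2) : F) = M ![0, 1] ∧
          (θ (gen (epsHalf k hℓ hζ) Gen.y1) : F) = M ![-1, 1] + M ![-1, 0] ∧
          (θ (gen (epsHalf k hℓ hζ) Gen.y2) : F) = M ![1, -1] + M ![0, -1]) ∧
        clusterAlgebra (epsHalf k hℓ hζ) (seedA2 ℓ M) =
          upperClusterAlgebra (epsHalf k hℓ hζ) (seedA2 ℓ M) ∧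
        (∃ b : Module.Basis PBWIndex (BaseRing k ζ)
              (clusterAlgebra (epsHalf k hℓ hζ) (seedA2 ℓ M)),
          ∀ p, (b p : F) = pbwMonomial (M ![1, 0]) (M ![0, 1])
            (M ![-1, 1] + M ![-1, 0]) (M ![1, -1] + M ![0, -1]) p)) ∧
    (∃ b : Module.Basis PBWIndex (BaseRing k ζ) (PresentedAlgebra (epsHalf k hℓ hζ)),
      ∀ p, b p = pbwMonomial (gen (epsHalf k hℓ hζ) Gen.x1) (gen (epsHalf k hℓ hζ) Gen.x2)
        (gen (epsHalf k hℓ hζ) Gen.y1) (gen (epsHalf k hℓ hζ) Gen.y2) p) ∧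
    (IsCompletelyIntegrallyClosed (BaseRing k ζ) →
      IsMaximalOrder (PresentedAlgebra (epsHalf k hℓ hζ))) := by
  obtain ⟨hcluster, hbasis, hmaximal⟩ := mainTheorem10_general (epsHalf k hℓ hζ) (epsHalf_pow hℓ hζ)
  exact ⟨hcluster, hbasis, hmaximal hℓ⟩
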